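/- Let $\{Z_t\}_{t\ge 0}$ be a real, mean zero, stationary Gaussian time series with autocovariance function $\gamma_0:\mathbb Z\to\mathbb R$ and spectral density $f_0(\lambda)=\frac1{2\pi}\sum_{k\in\mathbb Z}\gamma_0(k)e^{-ik\lambda}$. Let a second real, mean zero, stationary Gaussian time series (the parametric working model) be given, with autocovariance function $\gamma_{\mathrm{param}}$, spectral density $f_{\mathrm{param}}$ (defined in the same way), and Lebesgue density $p_{\mathrm{param}}$ of its observations at times $1,\dots,n$. Assume that for each $(\gamma,f)\in\{(\gamma_0,f_0),(\gamma_{\mathrm{param}},f_{\mathrm{param}})\}$ $$\sum_{h\in\mathbb Z}|h|^{\alpha}|\gamma(h)|<\infty\ \text{ for some }\alpha>1,\qquad f(\lambda)\ge\beta\ \text{ for some }\beta>0\text{ and all }-\pi\le\lambda\le\pi ,$$ where $\alpha$ and $\beta$ may differ between the two. For $n\ge1$ put $\lambda_j=2\pi j/n$, $N=\lfloor (n-1)/2\rfloor$, $\mathbf e_j=n^{-1/2}(e^{-2\pi i jt/n})_{t=1,\dots,n}$, $\mathbf c_j=\sqrt2\,\Re\mathbf e_j$, $\mathbf s_j=\sqrt2\,\Im\mathbf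 e_j$, and let $F_n$ be the orthonormal $n\times n$ matrix with rows $\mathbf e_0,\mathbf c_1,\mathbf s_1,\dots,\mathbf c_N,\mathbf s_N$ and, if $n$ is even, the additional last row $\mathbf e_{n/2}$. With $c=f_0/f_{\mathrm{param}}$ let $C_n$ be the diagonal matrix with entries $c(\lambda_0),c(\lambda_1),c(\lambda_1),\dots,c(\lambda_N),c(\lambda_N)$ and, if $n$ is even, the additional last entry $c(\lambda_{n/2})$. Let $I_{n,\lambda}(\mathbf z)=\frac1{2\pi n}\bigl|\sum_{t=1}^n z_te^{-it\lambda}\bigr|^2$ be the periodogram. Consider the following three probability distributions on $\mathbb R^n$: 1. the true distribution $P_{n,f_0}$ of $(Z_1,\dots,Z_n)$; 2. the Whittle distribution, with Lebesgue density $$p^W(\mathbf z\mid f_0)\propto\exp\Bigl\{-\tfrac12\sum_{j=0}^{n-1}\Bigl(\log f_0(\lambda_j)+\frac{I_{n,\lambda_j}(\mathbf z)}{f_0(\lambda_j)}\Bigr)\Bigr\};$$ 3. the nonparametrically corrected parametric distribution, with Lebesgue density $$p^C_{\mathrm{param}}(\mathbf z\mid f_0)\propto\det(C_n)^{-1/2}\,p_{\mathrm{param}}\bigl(F_n^TC_n^{-1/2}F_n\mathbf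 z\bigr).$$ Then these three sequences of distributions are, as $n\to\infty$, pairwise mutually contiguous: for any two of them, $(P_n)$ and $(Q_n)$, and any measurable sets $A_n\subseteq\mathbb R^n$, one has $P_n(A_n)\to0$ if and only if $Q_n(A_n)\to0$. -/

import Mathlib

open MeasureTheory ProbabilityTheory Filter
open scoped ENNReal Matrix Topology

noncomputable section

namespace Whittle

/-! ### Stationary Gaussian time series and spectral densities -/

/-- `{Z_t : t = 0, 1, …}` is a real, mean zero, stationary Gaussian time series under `P` with
autocovariance function `γ : ℤ → ℝ`, `Cov(Z_s, Z_t) = γ(t - s)`. -/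
structure IsStationaryGaussianSeries {Ω : Type*} [MeasurableSpace Ω] (P : Measure Ω)
    (Z : ℕ → Ω → ℝ) (γ : ℤ → ℝ) : Prop where
  gaussian : IsGaussianProcess Z P
  mean_zero : ∀ t, ∫ ω, Z t ω ∂P = 0
  autocov : ∀ s t : ℕ, covariance (Z s) (Z t) P = γ ((t : ℤ) - (s : ℤ))

/-- The spectral density `f(x) = (1 / 2π) ∑_{k ∈ ℤ} γ(k) exp(-i k x)`. The sum is real because
autocovariance functions are even; the real part only changes the codomain. -/
def spectralDensity (γ : ℤ → ℝ) (x : ℝ) : ℝ :=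
  (1 / (2 * (Real.pi : ℂ)) *
    ∑' k : ℤ, (γ k : ℂ) * Complex.exp (-Complex.I * (k : ℂ) * (x : ℂ))).re

/-- The regularity assumption on an autocovariance function: `∑ |h|^α |γ(h)| < ∞` for some
`α > 1`, and the spectral density is bounded below by some `β > 0` on `[-π, π]`. -/
def SpectralAssumption (γ : ℤ → ℝ) : Prop :=
  (∃ α : ℝ, 1 < α ∧ Summable fun h : ℤ => |(h : ℝ)| ^ α * |γ h|) ∧
  (∃ β : ℝ, 0 < β ∧ ∀ x ∈ Set.Icc (-Real.pi) Real.pi, β ≤ spectralDensity γ x)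

/-- The distribution of `(Z_1, …, Z_n)`; coordinate `t : Fin n` carries `Z_{t+1}`. -/
def seriesLaw {Ω : Type*} [MeasurableSpace Ω] (P : Measure Ω) (Z : ℕ → Ω → ℝ) (n : ℕ) :
    Measure (Fin n → ℝ) :=
  P.map fun ω (t : Fin n) => Z ((t : ℕ) + 1) ω

/-- The Lebesgue density of `(Z_1, …, Z_n)`. -/
def seriesDensity {Ω : Type*} [MeasurableSpace Ω] (P : Measure Ω) (Z : ℕ → Ω → ℝ) (n : ℕ) :
    (Fin n → ℝ) → ℝ≥0∞ :=
  (seriesLaw P Z n).rnDeriv volume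

/-! ### Fourier frequencies, periodogram and the real Fourier matrix -/

/-- The Fourier frequency `λ_j = 2πj/n`. -/
def fourierFreq (n j : ℕ) : ℝ := 2 * Real.pi * (j : ℝ) / (n : ℝ)

/-- The periodogram `I_n(x) = (1 / 2πn) |∑_{t=1}^n z_t exp(-i t x)|²`. -/
def periodogram (n : ℕ) (z : Fin n → ℝ) (x : ℝ) : ℝ :=
  1 / (2 * Real.pi * (n : ℝ)) *
    ‖∑ t : Fin n, (z t : ℂ) * Complex.exp (-Complex.I * ((t : ℕ) + 1 : ℂ) * (x : ℂ))‖ ^ 2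

/-- The vector `e_j = n^{-1/2} (e_j, e_j², …, e_j^n)` with `e_j = exp(-2πij/n)`. -/
def fourierVec (n j : ℕ) (t : Fin n) : ℂ :=
  (((n : ℝ) ^ (-(1 / 2) : ℝ) : ℝ) : ℂ) *
    Complex.exp (-2 * (Real.pi : ℂ) * Complex.I * (j : ℂ) / (n : ℂ)) ^ ((t : ℕ) + 1)

/-- The orthonormal `n × n` matrix `F_n` with rows `e_0, c_1, s_1, …, c_N, s_N` and, for even `n`,
the last row `e_{n/2}`; here `N = ⌊(n-1)/2⌋`, `c_j = √2 Re e_j` and `s_j = √2 Im e_j`. Row `i`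
belongs to the Fourier frequency with index `(i + 1) / 2`; the vectors `e_0` and `e_{n/2}` are
real. -/
def fourierMatrix (n : ℕ) : Matrix (Fin n) (Fin n) ℝ :=
  Matrix.of fun i t =>
    if (i : ℕ) = 0 ∨ (Even n ∧ (i : ℕ) + 1 = n) then (fourierVec n (((i : ℕ) + 1) / 2) t).re
    else if Odd (i : ℕ) then √2 * (fourierVec n (((i : ℕ) + 1) / 2) t).re
    else √2 * (fourierVec n (((i : ℕ) + 1) / 2) t).im

/-- The entries `c(λ_0), c(λ_1), c(λ_1), …, c(λ_N), c(λ_N)` and, for even `n`, `c(λ_{n/2})`. -/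
def freqDiag (c : ℝ → ℝ) (n : ℕ) (i : Fin n) : ℝ := c (fourierFreq n (((i : ℕ) + 1) / 2))

/-- The correction matrix `C_n(c)`. -/
def correctionMatrix (c : ℝ → ℝ) (n : ℕ) : Matrix (Fin n) (Fin n) ℝ :=
  Matrix.diagonal (freqDiag c n)

/-- The matrix `C_n(c)^{-1/2}`, for positive `c`. -/
def correctionInvSqrt (c : ℝ → ℝ) (n : ℕ) : Matrix (Fin n) (Fin n) ℝ :=
  Matrix.diagonal fun i => freqDiag c n i ^ (-(1 / 2) : ℝ)

/-! ### The Whittle and the corrected likelihood -/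

/-- The probability distribution on `ℝⁿ` whose Lebesgue density is proportional to `g`. -/
def normalizedLaw {n : ℕ} (g : (Fin n → ℝ) → ℝ≥0∞) : Measure (Fin n → ℝ) :=
  (∫⁻ z, g z)⁻¹ • (volume : Measure (Fin n → ℝ)).withDensity g

/-- The Whittle likelihood with spectral density `f`:
`p^W(z | f) ∝ exp{-(1/2) ∑_{j=0}^{n-1} (log f(λ_j) + I_n(λ_j) / f(λ_j))}`. -/
def whittleLaw (f : ℝ → ℝ) (n : ℕ) : Measure (Fin n → ℝ) :=
  normalizedLaw fun z => ENNReal.ofReal (Real.exp (-(1 / 2) * ∑ j ∈ Finset.range n,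
    (Real.log (f (fourierFreq n j)) +
      periodogram n z (fourierFreq n j) / f (fourierFreq n j))))

/-- The nonparametrically corrected likelihood with spectral density `f`, for a working model with
spectral density `fparam` and density `pparam` of the first `n` observations:
`p^C(z | f) ∝ det(C_n)^{-1/2} pparam(F_nᵀ C_n^{-1/2} F_n z)` with `C_n = C_n(f / fparam)`. -/
def correctedLaw (f fparam : ℝ → ℝ) (n : ℕ) (pparam : (Fin n → ℝ) → ℝ≥0∞) :
    Measure (Fin n → ℝ) :=
  normalizedLaw fun z =>
    ENNReal.ofReal ((correctionMatrix (fun x => f x / fparam x) n).det ^ (-(1 / 2) : ℝ)) *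
      pparam (((fourierMatrix n)ᵀ * correctionInvSqrt (fun x => f x / fparam x) n *
        fourierMatrix n) *ᵥ z)

/-! ### Contiguity -/

/-- `Q` is contiguous with respect to `P`: `P_n(A_n) → 0` implies `Q_n(A_n) → 0` for every sequence
of measurable sets. -/
def Contiguous {X : ℕ → Type*} [∀ n, MeasurableSpace (X n)] (Q P : ∀ n, Measure (X n)) : Prop :=
  ∀ A : ∀ n, Set (X n), (∀ n, MeasurableSet (A n)) →
    Tendsto (fun n => P n (A n)) atTop (𝓝 0) → Tendsto (fun n => Q n (A n)) atTop (𝓝 0)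

/-- Mutual contiguity of two sequences of measures. -/
def MutuallyContiguous {X : ℕ → Type*} [∀ n, MeasurableSpace (X n)]
    (P Q : ∀ n, Measure (X n)) : Prop :=
  Contiguous Q P ∧ Contiguous P Q

end Whittle

end

/-!
Whittle's likelihood replaces the Toeplitz covariance matrix of the series by the circulant matrix
with eigenvalues `2πf(λ_j)`, whose entries are the autocovariances aliased modulo `n`. A lag `k` is
aliased to at most `|k|` wrong entries of an `n × n` matrix, so the two covariance matrices differ
by a bounded amount in Frobenius norm, uniformly in `n`.

After whitening by the circulant matrix, an orthogonal change of variables diagonalizes both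
covariances: the Whittle law becomes standard Gaussian and the law of the series becomes a product
of centred Gaussians with variances `l_i`, where `l_i` is bounded away from zero and
`∑ (l_i - 1)²` is bounded. The terms linear in `l_i - 1` cancel in the moments of order `1 + δ` of
the likelihood ratio, so these moments are bounded, and Hölder's inequality gives
`P_n(A) ≤ C Q_n(A)^θ` with constants independent of `n` and `A`.

The map `F_nᵀ C_n^{-1/2} F_n` carries the Whittle law of `f₀` to the Whittle law of `f_param` and
the corrected law to the law of the working model, so the second pair reduces to the first, applied
to the working model.
-/

namespace Whittle

open scoped NNReal

/-! ### Contiguity -/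

section Contiguity

variable {X Y : ℕ → Type*} [∀ n, MeasurableSpace (X n)] [∀ n, MeasurableSpace (Y n)]
  {P Q R : ∀ n, Measure (X n)}

lemma Contiguous.trans (hPQ : Contiguous P Q) (hQR : Contiguous Q R) : Contiguous P R :=
  fun A hA h => hPQ A hA (hQR A hA h)

lemma MutuallyContiguous.trans (hPQ : MutuallyContiguous P Q) (hQR : MutuallyContiguous Q R) :
    MutuallyContiguous P R :=
  ⟨hQR.1.trans hPQ.1, hPQ.2.trans hQR.2⟩

/-- A quantitative form of contiguity: `P_n(A) ≤ C Q_n(A)^θ` with a finite `C` and a `θ > 0` that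
depend neither on `n` nor on `A`. -/
def PowerDominated (P Q : ∀ n, Measure (X n)) : Prop :=
  ∃ C : ℝ≥0∞, C ≠ ∞ ∧ ∃ θ : ℝ, 0 < θ ∧
    ∀ n (A : Set (X n)), MeasurableSet A → P n A ≤ C * Q n A ^ θ

lemma PowerDominated.contiguous (h : PowerDominated P Q) : Contiguous P Q := by
  obtain ⟨C, hC, θ, hθ, hle⟩ := h
  intro A hA hQ
  have hbound : Tendsto (fun n => C * Q n (A n) ^ θ) atTop (𝓝 (C * 0 ^ θ)) :=
    ENNReal.Tendsto.const_mul ((ENNReal.continuous_rpow_const.tendsto 0).comp hQ) (Or.inr hC)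
  rw [ENNReal.zero_rpow_of_pos hθ, mul_zero] at hbound
  exact tendsto_of_tendsto_of_tendsto_of_le_of_le tendsto_const_nhds hbound
    (fun _ => zero_le) fun n => hle n _ (hA n)

lemma PowerDominated.absolutelyContinuous (h : PowerDominated P Q) (n : ℕ) : P n ≪ Q n := by
  obtain ⟨C, -, θ, hθ, hle⟩ := h
  refine Measure.AbsolutelyContinuous.mk fun A hA hQA => ?_
  simpa [hQA, ENNReal.zero_rpow_of_pos hθ] using hle n A hA

lemma PowerDominated.of_map {e : ∀ n, X n → Y n} (he : ∀ n, MeasurableEmbedding (e n))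
    (h : PowerDominated (fun n => (P n).map (e n)) fun n => (Q n).map (e n)) :
    PowerDominated P Q := by
  obtain ⟨C, hC, θ, hθ, hle⟩ := h
  refine ⟨C, hC, θ, hθ, fun n A hA => ?_⟩
  simpa [(he n).map_apply, Set.preimage_image_eq _ (he n).injective]
    using hle n (e n '' A) ((he n).measurableSet_image' hA)

lemma PowerDominated.mutuallyContiguous (hPQ : PowerDominated P Q) (hQP : PowerDominated Q P) :
    MutuallyContiguous P Q :=
  ⟨hQP.contiguous, hPQ.contiguous⟩

end Contiguity

/-! ### Densities -/

section Densities

variable {α β : Type*} [MeasurableSpace α] [MeasurableSpace β]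

lemma map_withDensity_comp (μ : Measure α) {e : α → β} (he : Measurable e) {h : β → ℝ≥0∞}
    (hh : Measurable h) : (μ.withDensity (h ∘ e)).map e = (μ.map e).withDensity h := by
  ext s hs
  rw [Measure.map_apply he hs, withDensity_apply _ (he hs), withDensity_apply _ hs,
    setLIntegral_map hs hh he]
  rfl

lemma withDensity_apply_le_lintegral_rpow_mul_rpow (μ : Measure α) {r : α → ℝ≥0∞}
    (hr : Measurable r) {p q : ℝ} (hpq : p.HolderConjugate q) {A : Set α} (hA : MeasurableSet A) :
    μ.withDensity r A ≤ (∫⁻ x, r x ^ p ∂μ) ^ (1 / p) * μ A ^ (1 / q) := by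
  have hind : A.indicator r = r * A.indicator (1 : α → ℝ≥0∞) := by
    ext x
    by_cases hx : x ∈ A <;> simp [hx]
  have hpow : (fun x => A.indicator (1 : α → ℝ≥0∞) x ^ q) = A.indicator 1 := by
    ext x
    by_cases hx : x ∈ A <;> simp [hx, hpq.symm.pos]
  calc μ.withDensity r A = ∫⁻ x, (r * A.indicator (1 : α → ℝ≥0∞)) x ∂μ := by
        rw [withDensity_apply _ hA, ← lintegral_indicator hA, hind]
    _ ≤ (∫⁻ x, r x ^ p ∂μ) ^ (1 / p) * (∫⁻ x, A.indicator (1 : α → ℝ≥0∞) x ^ q ∂μ) ^ (1 / q) :=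
        ENNReal.lintegral_mul_le_Lp_mul_Lq μ hpq hr.aemeasurable
          (measurable_one.indicator hA).aemeasurable
    _ = _ := by rw [hpow, lintegral_indicator_one hA]

variable {ι : Type*} {E : ι → Type*} [∀ i, MeasurableSpace (E i)]
  (μ : ∀ i, Measure (E i)) [∀ i, SigmaFinite (μ i)] {r : ∀ i, E i → ℝ≥0∞}

lemma lmarginal_finset_prod [DecidableEq ι] (hr : ∀ i, Measurable (r i)) (s : Finset ι) :
    (∫⋯∫⁻_s, (fun x => ∏ i ∈ s, r i (x i)) ∂μ) = fun _ => ∏ i ∈ s, ∫⁻ x, r i x ∂(μ i) := by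
  have hmeas (s : Finset ι) : Measurable fun x : ∀ i, E i => ∏ i ∈ s, r i (x i) :=
    Finset.measurable_fun_prod _ fun i _ => (hr i).comp (measurable_pi_apply i)
  induction s using Finset.induction_on with
  | empty => simp
  | insert j s hj ih =>
    have hinner (x : ∀ i, E i) :
        ∫⁻ y, ∏ i ∈ insert j s, r i (Function.update x j y i) ∂(μ j)
          = (∫⁻ y, r j y ∂(μ j)) * ∏ i ∈ s, r i (x i) := by
      rw [← lintegral_mul_const _ (hr j)]
      refine lintegral_congr fun y => ?_
      rw [Finset.prod_insert hj, Function.update_self]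
      congr 1
      refine Finset.prod_congr rfl fun i hi => ?_
      rw [Function.update_of_ne (ne_of_mem_of_not_mem hi hj)]
    rw [lmarginal_insert' _ (hmeas _) hj]
    simp only [hinner]
    ext x
    rw [Finset.prod_insert hj, ← congrFun ih x]
    exact lintegral_const_mul _ ((hmeas s).comp measurable_updateFinset)

variable [Fintype ι]

lemma lintegral_pi_prod (hr : ∀ i, Measurable (r i)) :
    ∫⁻ x, ∏ i, r i (x i) ∂(Measure.pi μ) = ∏ i, ∫⁻ x, r i x ∂(μ i) := by
  classical
  by_cases hE : Nonempty (∀ i, E i)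
  · obtain ⟨x⟩ := hE
    rw [lintegral_eq_lmarginal_univ x, lmarginal_finset_prod μ hr]
  · have := not_nonempty_iff.1 hE
    obtain ⟨i, hi⟩ := isEmpty_pi.1 this
    rw [lintegral_of_isEmpty]
    exact (Finset.prod_eq_zero (Finset.mem_univ i) (lintegral_of_isEmpty _ _)).symm

lemma pi_withDensity [∀ i, SigmaFinite ((μ i).withDensity (r i))] (hr : ∀ i, Measurable (r i)) :
    Measure.pi (fun i => (μ i).withDensity (r i))
      = (Measure.pi μ).withDensity fun x => ∏ i, r i (x i) := by
  refine Measure.pi_eq fun s hs => ?_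
  have hind : (Set.univ.pi s).indicator (fun x : ∀ i, E i => ∏ i, r i (x i))
      = fun x => ∏ i, (s i).indicator (r i) (x i) := by
    ext x
    by_cases hx : x ∈ Set.univ.pi s
    · rw [Set.indicator_of_mem hx]
      exact Finset.prod_congr rfl fun i _ => by rw [Set.indicator_of_mem (hx i (Set.mem_univ i))]
    · obtain ⟨i, hi⟩ : ∃ i, x i ∉ s i := by simpa using hx
      rw [Set.indicator_of_notMem hx]
      exact (Finset.prod_eq_zero (Finset.mem_univ i) (Set.indicator_of_notMem hi _)).symm
  rw [withDensity_apply _ (MeasurableSet.univ_pi hs), ← lintegral_indicator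
    (MeasurableSet.univ_pi hs), hind, lintegral_pi_prod μ fun i => (hr i).indicator (hs i)]
  exact Finset.prod_congr rfl fun i _ => by
    rw [lintegral_indicator (hs i), withDensity_apply _ (hs i)]

end Densities

/-! ### Normalized laws -/

section NormalizedLaw

variable {n : ℕ} {A : Matrix (Fin n) (Fin n) ℝ}

lemma measurableEmbedding_mulVec (hA : IsUnit A) :
    MeasurableEmbedding fun z : Fin n → ℝ => A *ᵥ z :=
  (Continuous.matrix_mulVec continuous_const continuous_id).measurableEmbedding
    (Matrix.mulVec_injective_iff_isUnit.2 hA)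

lemma normalizedLaw_of_withDensity_eq {h : (Fin n → ℝ) → ℝ≥0∞} {μ : Measure (Fin n → ℝ)}
    [IsProbabilityMeasure μ] (hμ : (volume : Measure (Fin n → ℝ)).withDensity h = μ) :
    normalizedLaw h = μ := by
  have hone : ∫⁻ z, h z = 1 := by
    rw [← setLIntegral_univ, ← withDensity_apply _ MeasurableSet.univ, hμ, measure_univ]
  rw [normalizedLaw, hone, hμ, inv_one, one_smul]

lemma normalizedLaw_const_mul {c : ℝ≥0∞} (hc : c ≠ 0) (hc' : c ≠ ∞) {h : (Fin n → ℝ) → ℝ≥0∞}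
    (hh : Measurable h) : normalizedLaw (fun z => c * h z) = normalizedLaw h := by
  have hwd : (volume : Measure (Fin n → ℝ)).withDensity (fun z => c * h z)
      = c • (volume : Measure (Fin n → ℝ)).withDensity h := withDensity_smul _ hh
  rw [normalizedLaw, normalizedLaw, lintegral_const_mul _ hh, hwd, smul_smul,
    ENNReal.mul_inv (Or.inl hc) (Or.inl hc'), mul_right_comm, ENNReal.inv_mul_cancel hc hc',
    one_mul]

lemma map_normalizedLaw_mulVec (hA : IsUnit A) {h : (Fin n → ℝ) → ℝ≥0∞} (hh : Measurable h) :
    (normalizedLaw fun z => h (A *ᵥ z)).map (fun z => A *ᵥ z) = normalizedLaw h := by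
  have hdet : A.det ≠ 0 := ((Matrix.isUnit_iff_isUnit_det A).1 hA).ne_zero
  have hm := (measurableEmbedding_mulVec hA).measurable
  have hvol : (volume : Measure (Fin n → ℝ)).map (fun z => A *ᵥ z)
      = ENNReal.ofReal |A.det⁻¹| • volume :=
    Real.map_matrix_volume_pi_eq_smul_volume_pi hdet
  have hk : ENNReal.ofReal |A.det⁻¹| ≠ 0 := by simp [hdet]
  have hint : ∫⁻ z, h (A *ᵥ z) = ENNReal.ofReal |A.det⁻¹| * ∫⁻ z, h z := by
    rw [← lintegral_map hh hm, hvol, lintegral_smul_measure, smul_eq_mul]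
  have hmap : ((volume : Measure (Fin n → ℝ)).withDensity fun z => h (A *ᵥ z)).map
      (fun z => A *ᵥ z) = ENNReal.ofReal |A.det⁻¹| • volume.withDensity h := by
    rw [← withDensity_smul_measure, ← hvol]
    exact map_withDensity_comp volume hm hh
  rw [normalizedLaw, normalizedLaw, Measure.map_smul, hint, hmap, smul_smul,
    ENNReal.mul_inv (Or.inl hk) (Or.inl ENNReal.ofReal_ne_top), mul_right_comm,
    ENNReal.inv_mul_cancel hk ENNReal.ofReal_ne_top, one_mul]

end NormalizedLaw

/-! ### Products of Gaussian laws -/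

section GaussianRatio

variable {u v : ℝ≥0}

lemma gaussianPDFReal_eq_exp (m : ℝ) (hv : v ≠ 0) (x : ℝ) :
    gaussianPDFReal m v x
      = Real.exp (-(1 / 2) * Real.log (2 * Real.pi * v) - (x - m) ^ 2 / (2 * v)) := by
  have h2 : 0 < 2 * Real.pi * v := by positivity
  simp only [gaussianPDFReal_def]
  rw [sub_eq_add_neg (-(1 / 2) * _), Real.exp_add, neg_div]
  congr 1
  rw [Real.sqrt_eq_rpow, ← Real.rpow_neg h2.le, Real.rpow_def_of_pos h2]
  ring_nf

/-- The likelihood ratio of two Gaussian laws on the line with common mean `m` and variances `u`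
and `v`. -/
noncomputable def gaussianRatio (m : ℝ) (u v : ℝ≥0) (x : ℝ) : ℝ≥0∞ :=
  gaussianPDF m u x / gaussianPDF m v x

lemma measurable_gaussianRatio (m : ℝ) (u v : ℝ≥0) : Measurable (gaussianRatio m u v) :=
  (measurable_gaussianPDF m u).div (measurable_gaussianPDF m v)

lemma gaussianReal_withDensity_gaussianRatio (m : ℝ) (hu : u ≠ 0) (hv : v ≠ 0) :
    (gaussianReal m v).withDensity (gaussianRatio m u v) = gaussianReal m u := by
  rw [gaussianReal_of_var_ne_zero _ hu, gaussianReal_of_var_ne_zero _ hv,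
    ← withDensity_mul _ (measurable_gaussianPDF _ _) (measurable_gaussianRatio m u v)]
  congr 1
  ext x
  exact ENNReal.mul_div_cancel (gaussianPDF_pos m hv x).ne' gaussianPDF_ne_top

lemma gaussianPDF_mul_gaussianRatio_rpow {δ : ℝ} (m : ℝ) (hu : u ≠ 0) (hv : v ≠ 0) {w : ℝ≥0}
    (hw : w ≠ 0) (hδ : (w : ℝ) * (1 - δ * (u / v - 1)) = u) (x : ℝ) :
    gaussianPDF m v x * gaussianRatio m u v x ^ (1 + δ)
      = ENNReal.ofReal (Real.exp (-(1 / 2) *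
          (δ * Real.log (u / v) + Real.log (1 - δ * (u / v - 1))))) * gaussianPDF m w x := by
  have hw' : (w : ℝ) ≠ 0 := by exact_mod_cast hw
  have hden : 1 - δ * (u / v - 1) = (u : ℝ) / w := by
    rw [eq_div_iff hw', mul_comm, hδ]
  have hlog {y : ℝ≥0} (hy : y ≠ 0) :
      Real.log (2 * Real.pi * y) = Real.log (2 * Real.pi) + Real.log y :=
    Real.log_mul (by positivity) (by exact_mod_cast hy)
  have hquad : (x - m) ^ 2 / (2 * w)
      = (1 + δ) * ((x - m) ^ 2 / (2 * u)) - δ * ((x - m) ^ 2 / (2 * v)) := by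
    have hinv : (w : ℝ)⁻¹ = (1 + δ) / u - δ / v := by
      field_simp at hδ ⊢
      linear_combination -hδ
    linear_combination (x - m) ^ 2 / 2 * hinv
  rw [gaussianRatio, gaussianPDF, gaussianPDF, gaussianPDF, gaussianPDFReal_eq_exp m hu,
    gaussianPDFReal_eq_exp m hv, gaussianPDFReal_eq_exp m hw,
    ← ENNReal.ofReal_div_of_pos (Real.exp_pos _), ← Real.exp_sub,
    ENNReal.ofReal_rpow_of_pos (Real.exp_pos _), ← Real.exp_mul,
    ← ENNReal.ofReal_mul (Real.exp_pos _).le, ← ENNReal.ofReal_mul (Real.exp_pos _).le,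
    ← Real.exp_add, ← Real.exp_add, hden, Real.log_div (by positivity) (by positivity),
    Real.log_div (by positivity) (by positivity), hlog hu, hlog hv, hlog hw, hquad]
  congr 2
  ring

lemma lintegral_gaussianRatio_rpow {δ : ℝ} (m : ℝ) (hu : u ≠ 0) (hv : v ≠ 0)
    (hδ : 0 < 1 - δ * ((u : ℝ) / v - 1)) :
    ∫⁻ x, gaussianRatio m u v x ^ (1 + δ) ∂(gaussianReal m v)
      = ENNReal.ofReal (Real.exp (-(1 / 2) *
          (δ * Real.log (u / v) + Real.log (1 - δ * (u / v - 1))))) := by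
  obtain ⟨w, hw⟩ : ∃ w : ℝ≥0, (w : ℝ) = u / (1 - δ * (u / v - 1)) :=
    ⟨⟨_, by positivity⟩, rfl⟩
  have hw0 : w ≠ 0 := by
    have : (0 : ℝ) < w := hw ▸ by positivity
    exact_mod_cast this.ne'
  have hwδ : (w : ℝ) * (1 - δ * (u / v - 1)) = u := by rw [hw, div_mul_cancel₀ _ hδ.ne']
  rw [gaussianReal_of_var_ne_zero _ hv, lintegral_withDensity_eq_lintegral_mul _
    (measurable_gaussianPDF _ _) ((measurable_gaussianRatio m u v).pow_const _)]
  simp only [Pi.mul_apply, gaussianPDF_mul_gaussianRatio_rpow m hu hv hw0 hwδ]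
  rw [lintegral_const_mul _ (measurable_gaussianPDF _ _), lintegral_gaussianPDF_eq_one _ hw0,
    mul_one]

lemma neg_log_le_of_le {c x : ℝ} (hc : 0 < c) (hx : c ≤ x) :
    -Real.log x ≤ (1 - x) + (1 - x) ^ 2 / c := by
  have hx0 : 0 < x := hc.trans_le hx
  calc -Real.log x ≤ x⁻¹ - 1 := by linarith [Real.one_sub_inv_le_log_of_pos hx0]
    _ = (1 - x) + (1 - x) ^ 2 / x := by field_simp; ring
    _ ≤ (1 - x) + (1 - x) ^ 2 / c := by gcongr

lemma lintegral_gaussianRatio_rpow_le {a δ : ℝ} (m : ℝ) (ha : 0 < a) (hau : a ≤ (u : ℝ) / v)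
    (hδ : 0 ≤ δ) (hδu : δ * ((u : ℝ) / v - 1) ≤ 1 / 2) (hu : u ≠ 0) (hv : v ≠ 0) :
    ∫⁻ x, gaussianRatio m u v x ^ (1 + δ) ∂(gaussianReal m v)
      ≤ ENNReal.ofReal (Real.exp ((δ / a + 2 * δ ^ 2) * ((u : ℝ) / v - 1) ^ 2)) := by
  rw [lintegral_gaussianRatio_rpow m hu hv (by linarith)]
  refine ENNReal.ofReal_le_ofReal (Real.exp_le_exp.2 ?_)
  set l : ℝ := u / v
  -- The terms linear in `l - 1` cancel.
  have hlog := mul_le_mul_of_nonneg_left (neg_log_le_of_le ha hau) hδ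
  have hlogδ := neg_log_le_of_le (c := 1 / 2) (x := 1 - δ * (l - 1)) (by norm_num) (by linarith)
  have hsum : δ * ((1 - l) + (1 - l) ^ 2 / a) + ((1 - (1 - δ * (l - 1)))
      + (1 - (1 - δ * (l - 1))) ^ 2 / (1 / 2)) = (δ / a + 2 * δ ^ 2) * (l - 1) ^ 2 := by
    ring
  have hnonneg : 0 ≤ (δ / a + 2 * δ ^ 2) * (l - 1) ^ 2 := by positivity
  linarith

end GaussianRatio

section PiGaussian

variable {ι : Type*} [Fintype ι] {u v : ι → ℝ≥0}

lemma pi_gaussianReal_withDensity_prod_gaussianRatio (m : ι → ℝ) (hu : ∀ i, u i ≠ 0)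
    (hv : ∀ i, v i ≠ 0) :
    (Measure.pi fun i => gaussianReal (m i) (v i)).withDensity
        (fun x => ∏ i, gaussianRatio (m i) (u i) (v i) (x i))
      = Measure.pi fun i => gaussianReal (m i) (u i) := by
  have hratio (i : ι) := gaussianReal_withDensity_gaussianRatio (m i) (hu i) (hv i)
  have (i : ι) : SigmaFinite
      ((gaussianReal (m i) (v i)).withDensity (gaussianRatio (m i) (u i) (v i))) := by
    rw [hratio i]
    infer_instance
  rw [← pi_withDensity _ fun i => measurable_gaussianRatio (m i) (u i) (v i)]
  simp only [hratio]

lemma lintegral_prod_gaussianRatio_rpow_le {a K δ : ℝ} (m : ι → ℝ) (ha : 0 < a)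
    (hau : ∀ i, a ≤ (u i : ℝ) / v i) (hK : ∑ i, ((u i : ℝ) / v i - 1) ^ 2 ≤ K) (hδ : 0 ≤ δ)
    (hδK : δ * (K + 1) ≤ 1 / 2) (hu : ∀ i, u i ≠ 0) (hv : ∀ i, v i ≠ 0) :
    ∫⁻ x, (∏ i, gaussianRatio (m i) (u i) (v i) (x i)) ^ (1 + δ)
        ∂(Measure.pi fun i => gaussianReal (m i) (v i))
      ≤ ENNReal.ofReal (Real.exp ((δ / a + 2 * δ ^ 2) * K)) := by
  have hδu (i : ι) : δ * ((u i : ℝ) / v i - 1) ≤ 1 / 2 := by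
    have hsq : ((u i : ℝ) / v i - 1) ^ 2 ≤ K :=
      (Finset.single_le_sum (f := fun i => ((u i : ℝ) / v i - 1) ^ 2) (fun i _ => sq_nonneg _)
        (Finset.mem_univ i)).trans hK
    have hle : (u i : ℝ) / v i - 1 ≤ K + 1 := by nlinarith
    exact (mul_le_mul_of_nonneg_left hle hδ).trans hδK
  simp only [← ENNReal.prod_rpow_of_nonneg (show 0 ≤ 1 + δ by positivity)]
  rw [lintegral_pi_prod (r := fun i y => gaussianRatio (m i) (u i) (v i) y ^ (1 + δ)) _
    fun i => (measurable_gaussianRatio _ _ _).pow_const _]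
  calc ∏ i, ∫⁻ x, gaussianRatio (m i) (u i) (v i) x ^ (1 + δ) ∂(gaussianReal (m i) (v i))
      ≤ ∏ i, ENNReal.ofReal (Real.exp ((δ / a + 2 * δ ^ 2) * ((u i : ℝ) / v i - 1) ^ 2)) :=
        Finset.prod_le_prod' fun i _ =>
          lintegral_gaussianRatio_rpow_le (m i) ha (hau i) hδ (hδu i) (hu i) (hv i)
    _ = ENNReal.ofReal
          (Real.exp ((δ / a + 2 * δ ^ 2) * ∑ i, ((u i : ℝ) / v i - 1) ^ 2)) := by
        rw [← ENNReal.ofReal_prod_of_nonneg fun i _ => (Real.exp_pos _).le, ← Real.exp_sum,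
          Finset.mul_sum]
    _ ≤ ENNReal.ofReal (Real.exp ((δ / a + 2 * δ ^ 2) * K)) := by gcongr

end PiGaussian

lemma powerDominated_pi_gaussianReal {ι : ℕ → Type*} [∀ n, Fintype (ι n)]
    {u v : ∀ n, ι n → ℝ≥0} (m : ∀ n, ι n → ℝ) {a K : ℝ} (ha : 0 < a)
    (hau : ∀ n i, a ≤ (u n i : ℝ) / v n i) (hK : ∀ n, ∑ i, ((u n i : ℝ) / v n i - 1) ^ 2 ≤ K) :
    PowerDominated (fun n => Measure.pi fun i => gaussianReal (m n i) (u n i))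
      fun n => Measure.pi fun i => gaussianReal (m n i) (v n i) := by
  have hK0 : 0 ≤ K := (Finset.sum_nonneg fun i _ => sq_nonneg _).trans (hK 0)
  have hratio (n : ℕ) (i : ι n) : (u n i : ℝ) / v n i ≠ 0 := (ha.trans_le (hau n i)).ne'
  have hu (n : ℕ) (i : ι n) : u n i ≠ 0 := fun h => hratio n i (by simp [h])
  have hv (n : ℕ) (i : ι n) : v n i ≠ 0 := fun h => hratio n i (by simp [h])
  obtain ⟨δ, hδ, hδK⟩ : ∃ δ : ℝ, 0 < δ ∧ δ * (K + 1) ≤ 1 / 2 :=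
    ⟨1 / (2 * (K + 1)), by positivity, by field_simp; rfl⟩
  have hconj := Real.HolderConjugate.conjExponent (show 1 < 1 + δ by linarith)
  refine ⟨ENNReal.ofReal (Real.exp ((δ / a + 2 * δ ^ 2) * K)) ^ (1 / (1 + δ)),
    (ENNReal.rpow_lt_top_of_nonneg (by positivity) ENNReal.ofReal_ne_top).ne,
    1 / (1 + δ).conjExponent, one_div_pos.2 hconj.symm.pos, fun n A hA => ?_⟩
  beta_reduce
  rw [← pi_gaussianReal_withDensity_prod_gaussianRatio (m n) (hu n) (hv n)]
  have hmeas : Measurable fun x : ι n → ℝ => ∏ i, gaussianRatio (m n i) (u n i) (v n i) (x i) :=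
    Finset.measurable_fun_prod _ fun i _ =>
      (measurable_gaussianRatio _ _ _).comp (measurable_pi_apply i)
  refine (withDensity_apply_le_lintegral_rpow_mul_rpow _ hmeas hconj hA).trans ?_
  gcongr
  exact lintegral_prod_gaussianRatio_rpow_le (m n) ha (hau n) (hK n) hδ.le hδK (hu n) (hv n)

/-! ### The standard Gaussian kernel -/

section GaussianKernel

variable {n : ℕ}

/-- The unnormalized Lebesgue density `exp(-|x|²/2)` of the standard Gaussian law on `ℝⁿ`. -/
noncomputable def gaussianKernel (x : Fin n → ℝ) : ℝ≥0∞ :=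
  ENNReal.ofReal (Real.exp (-(1 / 2) * (x ⬝ᵥ x)))

lemma measurable_gaussianKernel : Measurable (gaussianKernel (n := n)) := by
  unfold gaussianKernel dotProduct
  fun_prop

lemma gaussianKernel_mulVec_of_transpose_mul_self {U : Matrix (Fin n) (Fin n) ℝ}
    (hU : Uᵀ * U = 1) (x : Fin n → ℝ) : gaussianKernel (U *ᵥ x) = gaussianKernel x := by
  rw [gaussianKernel, gaussianKernel, Matrix.dotProduct_mulVec, ← Matrix.mulVec_transpose,
    Matrix.mulVec_mulVec, hU, Matrix.one_mulVec]

lemma volume_withDensity_prod_gaussianPDF {ι : Type*} [Fintype ι] (m : ι → ℝ) {v : ι → ℝ≥0}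
    (hv : ∀ i, v i ≠ 0) :
    (volume : Measure (ι → ℝ)).withDensity (fun x => ∏ i, gaussianPDF (m i) (v i) (x i))
      = Measure.pi fun i => gaussianReal (m i) (v i) := by
  have (i : ι) : SigmaFinite
      ((volume : Measure ℝ).withDensity (gaussianPDF (m i) (v i))) := by
    rw [← gaussianReal_of_var_ne_zero _ (hv i)]
    infer_instance
  rw [volume_pi, ← pi_withDensity _ fun i => measurable_gaussianPDF (m i) (v i)]
  simp only [gaussianReal_of_var_ne_zero _ (hv _)]

lemma prod_gaussianPDF_zero_one (x : Fin n → ℝ) :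
    ∏ i, gaussianPDF 0 1 (x i) = ENNReal.ofReal (√(2 * Real.pi))⁻¹ ^ n * gaussianKernel x := by
  have hpdf (y : ℝ) : gaussianPDF 0 1 y
      = ENNReal.ofReal (√(2 * Real.pi))⁻¹ * ENNReal.ofReal (Real.exp (-(1 / 2) * (y * y))) := by
    rw [gaussianPDF, gaussianPDFReal_def, ← ENNReal.ofReal_mul (by positivity)]
    simp only [NNReal.coe_one, mul_one, sub_zero]
    congr 3
    ring
  simp only [hpdf, Finset.prod_mul_distrib, Finset.prod_const, Finset.card_univ, Fintype.card_fin]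
  rw [← ENNReal.ofReal_prod_of_nonneg fun i _ => (Real.exp_pos _).le, ← Real.exp_sum,
    gaussianKernel, dotProduct, Finset.mul_sum]

lemma normalizedLaw_gaussianKernel (n : ℕ) :
    normalizedLaw (gaussianKernel (n := n)) = Measure.pi fun _ => gaussianReal 0 1 := by
  rw [← normalizedLaw_of_withDensity_eq
    (volume_withDensity_prod_gaussianPDF (fun _ : Fin n => 0) fun _ => one_ne_zero)]
  simp only [prod_gaussianPDF_zero_one]
  rw [normalizedLaw_const_mul (pow_ne_zero _ (by simp [Real.pi_pos])) (by finiteness)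
    measurable_gaussianKernel]

end GaussianKernel

/-! ### The real Fourier basis -/

section FourierBasis

variable {n : ℕ}

lemma fourierFreq_sub {j : ℕ} (hn : n ≠ 0) (hj : j ≤ n) :
    fourierFreq n (n - j) = 2 * Real.pi - fourierFreq n j := by
  rw [fourierFreq, fourierFreq, Nat.cast_sub hj]
  field_simp

lemma fourierFreq_half_mem_Icc (i : Fin n) :
    fourierFreq n (((i : ℕ) + 1) / 2) ∈ Set.Icc 0 Real.pi := by
  have hn : (0 : ℝ) < n := by exact_mod_cast i.pos
  have hle : (((((i : ℕ) + 1) / 2 : ℕ) : ℝ)) * 2 ≤ n := by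
    exact_mod_cast (Nat.div_mul_le_self _ 2).trans i.isLt
  refine ⟨by unfold fourierFreq; positivity, ?_⟩
  rw [fourierFreq, div_le_iff₀ hn]
  nlinarith [Real.pi_pos]

lemma sum_cos_mul_fourierFreq (n : ℕ) (h : ℤ) :
    ∑ j ∈ Finset.range n, Real.cos (h * fourierFreq n j) = if (n : ℤ) ∣ h then (n : ℝ) else 0 := by
  rcases eq_or_ne n 0 with rfl | hn
  · simp
  have hroot := Complex.isPrimitiveRoot_exp n hn
  obtain ⟨ζ, hζ⟩ : ∃ ζ, ζ = Complex.exp (2 * Real.pi * Complex.I / n) ^ h := ⟨_, rfl⟩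
  have hcos (j : ℕ) : Real.cos (h * fourierFreq n j) = (ζ ^ j).re := by
    have harg : (j : ℂ) * (h * (2 * Real.pi * Complex.I / n))
        = ((h * fourierFreq n j : ℝ) : ℂ) * Complex.I := by
      push_cast [fourierFreq]
      ring
    rw [hζ, ← Complex.exp_int_mul, ← Complex.exp_nat_mul, harg, Complex.exp_ofReal_mul_I_re]
  have hone : ζ = 1 ↔ (n : ℤ) ∣ h := hζ ▸ hroot.zpow_eq_one_iff_dvd h
  simp only [hcos, ← Complex.re_sum]
  split_ifs with hd
  · simp [hone.2 hd]
  · have hζn : ζ ^ n = 1 := by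
      rw [hζ, ← zpow_natCast, zpow_comm, zpow_natCast, hroot.pow_eq_one, one_zpow]
    rw [geom_sum_eq (hone.not.2 hd), hζn, sub_self, zero_div, Complex.zero_re]

lemma fourierVec_eq (j : ℕ) (t : Fin n) :
    fourierVec n j t = (((√n)⁻¹ : ℝ) : ℂ) *
      Complex.exp (((-((t : ℕ) + 1 : ℝ) * fourierFreq n j : ℝ) : ℂ) * Complex.I) := by
  unfold fourierVec
  rw [← Complex.exp_nat_mul, Real.rpow_neg (Nat.cast_nonneg n), ← Real.sqrt_eq_rpow]
  congr 2
  push_cast [fourierFreq]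
  ring

lemma fourierVec_re (j : ℕ) (t : Fin n) :
    (fourierVec n j t).re = (√n)⁻¹ * Real.cos (((t : ℕ) + 1) * fourierFreq n j) := by
  rw [fourierVec_eq, Complex.re_ofReal_mul, Complex.exp_ofReal_mul_I_re, neg_mul, Real.cos_neg]

lemma fourierVec_im (j : ℕ) (t : Fin n) :
    (fourierVec n j t).im = -((√n)⁻¹ * Real.sin (((t : ℕ) + 1) * fourierFreq n j)) := by
  rw [fourierVec_eq, Complex.im_ofReal_mul, Complex.exp_ofReal_mul_I_im, neg_mul, Real.sin_neg,
    mul_neg]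

lemma sin_mul_fourierFreq_eq_zero {i : ℕ} (hi : i = 0 ∨ (Even n ∧ i + 1 = n)) (k : ℕ) :
    Real.sin (k * fourierFreq n ((i + 1) / 2)) = 0 := by
  rcases hi with rfl | ⟨⟨m, rfl⟩, him⟩
  · simp [fourierFreq]
  · have hpi : fourierFreq (m + m) m = Real.pi := by
      have : (m : ℝ) ≠ 0 := by
        have : m ≠ 0 := by omega
        exact_mod_cast this
      push_cast [fourierFreq]
      field_simp
      ring
    rw [show (i + 1) / 2 = m by omega, hpi, Real.sin_nat_mul_pi]

/-- The sign of the second harmonic in the product of two entries of row `i` of `fourierMatrix n`: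
`1` for a cosine row, `-1` for a sine row, and `0` for the unpaired rows `e_0` and `e_{n/2}`. -/
noncomputable def fourierRowSign (n i : ℕ) : ℝ :=
  if i = 0 ∨ (Even n ∧ i + 1 = n) then 0 else if Odd i then 1 else -1

lemma fourierMatrix_apply_mul_apply (i s t : Fin n) :
    fourierMatrix n i s * fourierMatrix n i t
      = (n : ℝ)⁻¹ * (Real.cos (((s : ℤ) - (t : ℤ) : ℤ) * fourierFreq n (((i : ℕ) + 1) / 2))
        + fourierRowSign n i *
          Real.cos (((s : ℤ) + (t : ℤ) + 2 : ℤ) * fourierFreq n (((i : ℕ) + 1) / 2))) := by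
  have hn : (n : ℝ)⁻¹ = (√n)⁻¹ * (√n)⁻¹ := by
    rw [← mul_inv, Real.mul_self_sqrt (Nat.cast_nonneg n)]
  have htwo : √2 * √2 = (2 : ℝ) := Real.mul_self_sqrt (by norm_num)
  set x := fourierFreq n (((i : ℕ) + 1) / 2) with hx
  have hsub : (((s : ℤ) - (t : ℤ) : ℤ) : ℝ) * x
      = ((s : ℕ) + 1) * x - ((t : ℕ) + 1) * x := by push_cast; ring
  have hadd : (((s : ℤ) + (t : ℤ) + 2 : ℤ) : ℝ) * x
      = ((s : ℕ) + 1) * x + ((t : ℕ) + 1) * x := by push_cast; ring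
  rw [hsub, hadd, Real.cos_sub, Real.cos_add, hn]
  simp only [fourierMatrix, fourierRowSign, Matrix.of_apply, fourierVec_re, fourierVec_im, ← hx]
  split_ifs with hunpaired hodd
  · have hsin : Real.sin (((s : ℕ) + 1) * x) = 0 := by
      exact_mod_cast sin_mul_fourierFreq_eq_zero hunpaired (s + 1)
    rw [hsin]
    ring
  · linear_combination ((√n)⁻¹ * (√n)⁻¹ * Real.cos (((s : ℕ) + 1) * x)
      * Real.cos (((t : ℕ) + 1) * x)) * htwo
  · linear_combination ((√n)⁻¹ * (√n)⁻¹ * Real.sin (((s : ℕ) + 1) * x)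
      * Real.sin (((t : ℕ) + 1) * x)) * htwo

lemma sum_fourierRowSign_mul (n : ℕ) (φ : ℕ → ℝ) :
    ∑ i ∈ Finset.range n, fourierRowSign n i * φ ((i + 1) / 2) = 0 := by
  -- The involution swaps the rows `c_j` and `s_j`, which have opposite signs.
  refine Finset.sum_involution (fun i _ => if i = 0 ∨ (Even n ∧ i + 1 = n) then i
    else if Odd i then i + 1 else i - 1) ?_ ?_ ?_ ?_
  · intro i hi
    rw [Finset.mem_range] at hi
    have hhalf : Odd i → (i + 1 + 1) / 2 = (i + 1) / 2 := by grind
    have hhalf' : ¬Odd i → (i - 1 + 1) / 2 = (i + 1) / 2 := by grind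
    unfold fourierRowSign
    grind
  · intro i _
    unfold fourierRowSign
    grind
  · grind
  · grind

lemma sum_range_half {ψ : ℕ → ℝ} (hψ : ∀ j, 0 < j → j < n → ψ (n - j) = ψ j) :
    ∑ i ∈ Finset.range n, ψ ((i + 1) / 2) = ∑ j ∈ Finset.range n, ψ j := by
  refine Finset.sum_nbij' (fun i => if Even i ∧ i ≠ 0 then n - i / 2 else (i + 1) / 2)
    (fun j => if 2 * j ≤ n then 2 * j - 1 else 2 * (n - j)) ?_ ?_ ?_ ?_ ?_
  · grind
  · grind
  · grind
  · grind
  · intro i hi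
    have hhalf : Even i → (i + 1) / 2 = i / 2 := by grind
    grind

end FourierBasis

/-! ### Fourier multipliers -/

section FourierMultiplier

variable {n : ℕ} {g h : ℝ → ℝ}

/-- The matrix `F_nᵀ diag(g(λ)) F_n` that multiplies the discrete Fourier coefficients by the
symbol `g`. For `g` with `g(2π - x) = g(x)` it is the symmetric circulant matrix with eigenvalues
`g(λ_j)`. -/
noncomputable def fourierMultiplier (g : ℝ → ℝ) (n : ℕ) : Matrix (Fin n) (Fin n) ℝ :=
  (fourierMatrix n)ᵀ * Matrix.diagonal (freqDiag g n) * fourierMatrix n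

lemma fourierMultiplier_apply (hg : ∀ x, g (2 * Real.pi - x) = g x) (s t : Fin n) :
    fourierMultiplier g n s t = (n : ℝ)⁻¹ * ∑ j ∈ Finset.range n,
      g (fourierFreq n j) * Real.cos (((s : ℤ) - (t : ℤ) : ℤ) * fourierFreq n j) := by
  have hsymm (j : ℕ) (_ : 0 < j) (hj : j < n) :
      g (fourierFreq n (n - j)) * Real.cos (((s : ℤ) - (t : ℤ) : ℤ) * fourierFreq n (n - j))
        = g (fourierFreq n j) * Real.cos (((s : ℤ) - (t : ℤ) : ℤ) * fourierFreq n j) := by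
    rw [fourierFreq_sub (by omega) hj.le, hg, mul_sub, Real.cos_int_mul_two_pi_sub]
  have hsign := sum_fourierRowSign_mul n fun j =>
    g (fourierFreq n j) * Real.cos (((s : ℤ) + (t : ℤ) + 2 : ℤ) * fourierFreq n j)
  rw [← sum_range_half hsymm, ← add_zero (Finset.sum _ _), ← hsign, ← Finset.sum_add_distrib,
    ← Fin.sum_univ_eq_sum_range (n := n), Finset.mul_sum, fourierMultiplier, Matrix.mul_apply]
  refine Finset.sum_congr rfl fun i _ => ?_
  rw [Matrix.mul_diagonal, Matrix.transpose_apply, mul_right_comm, fourierMatrix_apply_mul_apply,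
    freqDiag]
  ring

lemma fourierMatrix_transpose_mul_self : (fourierMatrix n)ᵀ * fourierMatrix n = 1 := by
  have hone : fourierMultiplier (fun _ => 1) n = (fourierMatrix n)ᵀ * fourierMatrix n := by
    have hdiag : Matrix.diagonal (freqDiag (fun _ => 1) n) = 1 := Matrix.diagonal_one
    rw [fourierMultiplier, hdiag, Matrix.mul_one]
  ext s t
  have hn : (n : ℝ) ≠ 0 := by exact_mod_cast s.pos.ne'
  have hdvd : (n : ℤ) ∣ (s : ℤ) - t ↔ s = t := by
    refine ⟨fun hd => ?_, fun hst => by simp [hst]⟩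
    have := Int.eq_zero_of_abs_lt_dvd hd (by rw [abs_lt]; omega)
    omega
  rw [← hone, fourierMultiplier_apply fun _ => rfl]
  simp only [one_mul, sum_cos_mul_fourierFreq, hdvd, Matrix.one_apply]
  split_ifs <;> simp [hn]

lemma fourierMatrix_mul_transpose_self : fourierMatrix n * (fourierMatrix n)ᵀ = 1 :=
  mul_eq_one_comm.1 fourierMatrix_transpose_mul_self

lemma fourierMultiplier_congr (hgh : ∀ x ∈ Set.Icc 0 Real.pi, g x = h x) :
    fourierMultiplier g n = fourierMultiplier h n := by
  have : freqDiag g n = freqDiag h n := funext fun i => hgh _ (fourierFreq_half_mem_Icc i)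
  rw [fourierMultiplier, fourierMultiplier, this]

lemma fourierMultiplier_mul (g h : ℝ → ℝ) (n : ℕ) :
    fourierMultiplier g n * fourierMultiplier h n = fourierMultiplier (fun x => g x * h x) n := by
  simp only [fourierMultiplier, Matrix.mul_assoc]
  rw [← Matrix.mul_assoc (fourierMatrix n), fourierMatrix_mul_transpose_self, Matrix.one_mul,
    ← Matrix.mul_assoc (Matrix.diagonal _), Matrix.diagonal_mul_diagonal]
  rfl

lemma fourierMultiplier_const (c : ℝ) (n : ℕ) : fourierMultiplier (fun _ => c) n = c • 1 := by
  have : Matrix.diagonal (freqDiag (fun _ => c) n) = c • (1 : Matrix (Fin n) (Fin n) ℝ) :=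
    (Matrix.smul_one_eq_diagonal c).symm
  rw [fourierMultiplier, this, Matrix.mul_smul, Matrix.smul_mul, mul_one,
    fourierMatrix_transpose_mul_self]

lemma fourierMultiplier_sub (g h : ℝ → ℝ) (n : ℕ) :
    fourierMultiplier (fun x => g x - h x) n = fourierMultiplier g n - fourierMultiplier h n := by
  rw [fourierMultiplier, fourierMultiplier, fourierMultiplier, ← Matrix.sub_mul, ← Matrix.mul_sub,
    Matrix.diagonal_sub]
  rfl

lemma fourierMultiplier_transpose (g : ℝ → ℝ) (n : ℕ) :
    (fourierMultiplier g n)ᵀ = fourierMultiplier g n := by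
  simp only [fourierMultiplier, Matrix.transpose_mul, Matrix.transpose_transpose,
    Matrix.diagonal_transpose, Matrix.mul_assoc]

lemma isUnit_fourierMultiplier (hg : ∀ x ∈ Set.Icc 0 Real.pi, g x ≠ 0) :
    IsUnit (fourierMultiplier g n) := by
  refine IsUnit.of_mul_eq_one (fourierMultiplier (fun x => (g x)⁻¹) n) ?_
  rw [fourierMultiplier_mul, fourierMultiplier_congr (h := fun _ => 1)
    fun x hx => mul_inv_cancel₀ (hg x hx), fourierMultiplier_const, one_smul]

lemma posSemidef_fourierMultiplier (hg : ∀ x ∈ Set.Icc 0 Real.pi, 0 ≤ g x) :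
    (fourierMultiplier g n).PosSemidef :=
  (Matrix.PosSemidef.diagonal fun i => hg _ (fourierFreq_half_mem_Icc i)).conjTranspose_mul_mul_same
    (fourierMatrix n)

end FourierMultiplier

/-! ### Spectral densities, aliasing and Toeplitz matrices -/

/-- The regularity of an autocovariance function on which the comparison rests:
`∑ |k| |γ(k)| < ∞` and a spectral density that is bounded away from zero. -/
structure ShortMemory (γ : ℤ → ℝ) : Prop where
  summable_abs_mul : Summable fun k : ℤ => |(k : ℝ)| * |γ k|
  exists_le : ∃ β, 0 < β ∧ ∀ x ∈ Set.Icc (-Real.pi) Real.pi, β ≤ spectralDensity γ x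

lemma SpectralAssumption.shortMemory {γ : ℤ → ℝ} (hγ : SpectralAssumption γ) : ShortMemory γ := by
  obtain ⟨⟨α, hα, hsum⟩, hβ⟩ := hγ
  refine ⟨hsum.of_nonneg_of_le (fun k => by positivity) fun k => ?_, hβ⟩
  gcongr
  rcases eq_or_ne k 0 with rfl | hk
  · simpa using Real.rpow_nonneg le_rfl α
  · have hone : (1 : ℝ) ≤ |(k : ℝ)| := by exact_mod_cast Int.one_le_abs hk
    simpa using Real.rpow_le_rpow_of_exponent_le hone hα.le

lemma ShortMemory.summable_abs {γ : ℤ → ℝ} (hγ : ShortMemory γ) : Summable fun k => |γ k| := by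
  refine Summable.of_norm_bounded_eventually hγ.summable_abs_mul ?_
  filter_upwards [(Set.finite_singleton (0 : ℤ)).compl_mem_cofinite] with k hk
  have hone : (1 : ℝ) ≤ |(k : ℝ)| := by exact_mod_cast Int.one_le_abs hk
  simpa using le_mul_of_one_le_left (abs_nonneg (γ k)) hone

lemma ShortMemory.exists_le_two_pi_mul {γ : ℤ → ℝ} (hγ : ShortMemory γ) :
    ∃ b, 0 < b ∧ ∀ x ∈ Set.Icc 0 Real.pi, b ≤ 2 * Real.pi * spectralDensity γ x := by
  obtain ⟨β, hβ, hle⟩ := hγ.exists_le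
  refine ⟨2 * Real.pi * β, by positivity, fun x hx => ?_⟩
  gcongr
  exact hle x ⟨by linarith [hx.1, Real.pi_pos], hx.2⟩

lemma ShortMemory.spectralDensity_pos {γ : ℤ → ℝ} (hγ : ShortMemory γ) {x : ℝ}
    (hx : x ∈ Set.Icc 0 Real.pi) : 0 < spectralDensity γ x := by
  obtain ⟨b, hb, hle⟩ := hγ.exists_le_two_pi_mul
  exact pos_of_mul_pos_right (hb.trans_le (hle x hx)) Real.two_pi_pos.le

section Aliasing

variable {γ : ℤ → ℝ}

lemma summable_mul_cos (hγ : Summable fun k => |γ k|) (x : ℝ) :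
    Summable fun k : ℤ => γ k * Real.cos (k * x) := by
  refine Summable.of_norm_bounded hγ fun k => ?_
  rw [Real.norm_eq_abs, abs_mul]
  exact mul_le_of_le_one_right (abs_nonneg _) (Real.abs_cos_le_one _)

lemma summable_mul_sin (hγ : Summable fun k => |γ k|) (x : ℝ) :
    Summable fun k : ℤ => γ k * Real.sin (k * x) := by
  refine Summable.of_norm_bounded hγ fun k => ?_
  rw [Real.norm_eq_abs, abs_mul]
  exact mul_le_of_le_one_right (abs_nonneg _) (Real.abs_sin_le_one _)

lemma two_pi_mul_spectralDensity (hγ : Summable fun k => |γ k|) (x : ℝ) :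
    2 * Real.pi * spectralDensity γ x = ∑' k : ℤ, γ k * Real.cos (k * x) := by
  have hexp (k : ℤ) : -Complex.I * (k : ℂ) * (x : ℂ) = ((-(k * x) : ℝ) : ℂ) * Complex.I := by
    push_cast
    ring
  have hsum : Summable fun k : ℤ => (γ k : ℂ) * Complex.exp (-Complex.I * k * x) := by
    refine Summable.of_norm (hγ.congr fun k => ?_)
    rw [hexp, norm_mul, Complex.norm_exp_ofReal_mul_I, mul_one, Complex.norm_real,
      Real.norm_eq_abs]
  have hcoe : 1 / (2 * (Real.pi : ℂ)) = ((1 / (2 * Real.pi) : ℝ) : ℂ) := by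
    push_cast
    rfl
  rw [spectralDensity, hcoe, Complex.re_ofReal_mul, Complex.re_tsum hsum, ← mul_assoc,
    mul_one_div_cancel (by positivity), one_mul]
  refine tsum_congr fun k => ?_
  rw [hexp, Complex.re_ofReal_mul, Complex.exp_ofReal_mul_I_re, Real.cos_neg]

lemma spectralDensity_two_pi_sub (hγ : Summable fun k => |γ k|) (x : ℝ) :
    spectralDensity γ (2 * Real.pi - x) = spectralDensity γ x := by
  refine mul_left_cancel₀ Real.two_pi_pos.ne' ?_
  simp only [two_pi_mul_spectralDensity hγ, mul_sub, Real.cos_int_mul_two_pi_sub]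

lemma two_pi_mul_spectralDensity_le (hγ : Summable fun k => |γ k|) (x : ℝ) :
    2 * Real.pi * spectralDensity γ x ≤ ∑' k, |γ k| := by
  rw [two_pi_mul_spectralDensity hγ]
  refine (summable_mul_cos hγ x).tsum_le_tsum (fun k => (le_abs_self _).trans ?_) hγ
  rw [abs_mul]
  exact mul_le_of_le_one_right (abs_nonneg _) (Real.abs_cos_le_one _)

lemma tsum_mul_sin_eq_zero (heven : ∀ k, γ (-k) = γ k) (x : ℝ) :
    ∑' k : ℤ, γ k * Real.sin (k * x) = 0 := by
  rw [← self_eq_neg, ← tsum_neg, ← (Equiv.neg ℤ).tsum_eq]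
  refine tsum_congr fun k => ?_
  rw [Equiv.neg_apply, heven, Int.cast_neg, neg_mul, Real.sin_neg, mul_neg]

lemma two_pi_mul_spectralDensity_mul_cos (hγ : Summable fun k => |γ k|)
    (heven : ∀ k, γ (-k) = γ k) (h : ℤ) (x : ℝ) :
    2 * Real.pi * spectralDensity γ x * Real.cos (h * x)
      = ∑' k : ℤ, γ k * Real.cos ((k - h : ℤ) * x) := by
  have hadd (k : ℤ) : γ k * Real.cos ((k - h : ℤ) * x)
      = γ k * Real.cos (k * x) * Real.cos (h * x) + γ k * Real.sin (k * x) * Real.sin (h * x) := by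
    rw [Int.cast_sub, sub_mul, Real.cos_sub]
    ring
  simp only [hadd]
  rw [((summable_mul_cos hγ x).mul_right _).tsum_add ((summable_mul_sin hγ x).mul_right _),
    tsum_mul_right, tsum_mul_right, tsum_mul_sin_eq_zero heven, zero_mul, add_zero,
    two_pi_mul_spectralDensity hγ]

/-- The autocovariance function aliased modulo `n`, `∑_{k ≡ h mod n} γ(k)`. -/
noncomputable def aliasedCov (γ : ℤ → ℝ) (n : ℕ) (h : ℤ) : ℝ :=
  ∑' k : ℤ, if (n : ℤ) ∣ k - h then γ k else 0

lemma fourierMultiplier_spectralDensity_apply (hγ : Summable fun k => |γ k|)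
    (heven : ∀ k, γ (-k) = γ k) {n : ℕ} (s t : Fin n) :
    fourierMultiplier (fun x => 2 * Real.pi * spectralDensity γ x) n s t
      = aliasedCov γ n ((s : ℤ) - (t : ℤ)) := by
  have hn : (n : ℝ) ≠ 0 := by exact_mod_cast s.pos.ne'
  set h : ℤ := (s : ℤ) - (t : ℤ)
  have hsum (j : ℕ) : Summable fun k : ℤ => γ k * Real.cos ((k - h : ℤ) * fourierFreq n j) := by
    refine Summable.of_norm_bounded hγ fun k => ?_
    rw [Real.norm_eq_abs, abs_mul]
    exact mul_le_of_le_one_right (abs_nonneg _) (Real.abs_cos_le_one _)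
  rw [fourierMultiplier_apply fun x => by rw [spectralDensity_two_pi_sub hγ]]
  simp only [two_pi_mul_spectralDensity_mul_cos hγ heven]
  rw [← Summable.tsum_finsetSum fun j _ => hsum j, ← tsum_mul_left]
  refine tsum_congr fun k => ?_
  rw [← Finset.mul_sum, sum_cos_mul_fourierFreq, mul_left_comm]
  split_ifs <;> simp [hn]

lemma tsum_ite_eq_apply (h : ℤ) : ∑' k, (if k = h then γ k else 0) = γ h := by
  rw [tsum_eq_single h fun k hk => if_neg hk, if_pos rfl]

lemma tendsto_aliasedCov (hγ : Summable fun k => |γ k|) (h : ℤ) :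
    Tendsto (fun n => aliasedCov γ n h) atTop (𝓝 (γ h)) := by
  rw [← tsum_ite_eq_apply (γ := γ) h]
  refine tendsto_tsum_of_dominated_convergence hγ (fun k => ?_) (.of_forall fun n k => ?_)
  · refine tendsto_const_nhds.congr' ?_
    filter_upwards [eventually_gt_atTop (k - h).natAbs] with n hn
    have hdvd : (n : ℤ) ∣ k - h ↔ k = h := by
      refine ⟨fun hd => ?_, fun hkh => by simp [hkh]⟩
      have := Int.eq_zero_of_abs_lt_dvd hd (by rw [abs_lt]; omega)
      omega
    simp only [hdvd]
  · split_ifs <;> simp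

end Aliasing

section Toeplitz

variable {γ : ℤ → ℝ}

/-- The Toeplitz matrix `(γ(s - t))_{s,t}`, for even `γ` the covariance matrix of `n` consecutive
observations of a stationary series with autocovariance function `γ`. -/
def toeplitz (γ : ℤ → ℝ) (n : ℕ) : Matrix (Fin n) (Fin n) ℝ :=
  Matrix.of fun s t => γ ((s : ℤ) - (t : ℤ))

lemma toeplitz_transpose (heven : ∀ k, γ (-k) = γ k) (n : ℕ) :
    (toeplitz γ n)ᵀ = toeplitz γ n := by
  ext s t
  rw [Matrix.transpose_apply, toeplitz, Matrix.of_apply, Matrix.of_apply, ← heven, neg_sub]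

lemma posSemidef_of_tendsto {ι κ : Type*} [Finite κ] {l : Filter ι} [l.NeBot]
    {M : ι → Matrix κ κ ℝ} {A : Matrix κ κ ℝ} (hM : Tendsto M l (𝓝 A))
    (hpos : ∀ᶠ i in l, (M i).PosSemidef) : A.PosSemidef := by
  have := Fintype.ofFinite κ
  simp only [Matrix.posSemidef_iff_dotProduct_mulVec] at hpos ⊢
  refine ⟨?_, fun x => ?_⟩
  · have hT : Tendsto (fun i => (M i)ᴴ) l (𝓝 Aᴴ) :=
      (continuous_id.matrix_conjTranspose.tendsto A).comp hM
    exact tendsto_nhds_unique (hT.congr' (hpos.mono fun i hi => hi.1)) hM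
  · have hq : Continuous fun B : Matrix κ κ ℝ => star x ⬝ᵥ (B *ᵥ x) := by fun_prop
    exact ge_of_tendsto ((hq.tendsto A).comp hM) (hpos.mono fun i hi => hi.2 x)

/-- A Toeplitz matrix is a limit of principal submatrices of ever larger circulant matrices. -/
lemma posSemidef_toeplitz_sub (hγ : Summable fun k => |γ k|) (heven : ∀ k, γ (-k) = γ k) {b : ℝ}
    (hb : ∀ x ∈ Set.Icc 0 Real.pi, b ≤ 2 * Real.pi * spectralDensity γ x) (n : ℕ) :
    (toeplitz γ n - b • 1).PosSemidef := by
  have hlim : Tendsto (fun N => Matrix.of (fun s t : Fin n => aliasedCov γ N ((s : ℤ) - (t : ℤ)))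
      - b • 1) atTop (𝓝 (toeplitz γ n - b • 1)) := by
    refine Tendsto.sub_const ?_ _
    exact tendsto_pi_nhds.2 fun s => tendsto_pi_nhds.2 fun t => tendsto_aliasedCov hγ _
  refine posSemidef_of_tendsto hlim ?_
  filter_upwards [eventually_ge_atTop n] with N hN
  have hpos : (fourierMultiplier
      (fun x => 2 * Real.pi * spectralDensity γ x - b) N).PosSemidef :=
    posSemidef_fourierMultiplier fun x hx => sub_nonneg.2 (hb x hx)
  convert hpos.submatrix (Fin.castLE hN) using 1
  ext s t
  rw [fourierMultiplier_sub, fourierMultiplier_const, Matrix.submatrix_apply, Matrix.sub_apply,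
    Matrix.sub_apply, fourierMultiplier_spectralDensity_apply hγ heven]
  simp [Matrix.one_apply]

lemma card_aliased_le (n : ℕ) (k : ℤ) :
    (Finset.univ.filter fun p : Fin n × Fin n =>
      (n : ℤ) ∣ k - ((p.1 : ℤ) - (p.2 : ℤ)) ∧ k ≠ (p.1 : ℤ) - (p.2 : ℤ)).card ≤ k.natAbs := by
  rw [← Finset.card_range k.natAbs]
  refine Finset.card_le_card_of_injOn
    (fun p => if 0 ≤ k then n - 1 - (p.2 : ℕ) else p.2) ?_ ?_
  · rintro ⟨s, t⟩ hst
    obtain ⟨hdvd, hne⟩ : (n : ℤ) ∣ k - ((s : ℤ) - (t : ℤ)) ∧ k ≠ (s : ℤ) - (t : ℤ) := by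
      simpa using hst
    have hout : (t : ℤ) + k < 0 ∨ (n : ℤ) ≤ t + k := by
      by_contra! hin
      have := Int.eq_zero_of_abs_lt_dvd hdvd (by rw [abs_lt]; omega)
      omega
    simp only [Finset.coe_range, Set.mem_Iio]
    split_ifs <;> omega
  · rintro ⟨s, t⟩ hst ⟨s', t'⟩ hst' heq
    obtain ⟨hdvd, -⟩ : (n : ℤ) ∣ k - ((s : ℤ) - (t : ℤ)) ∧ k ≠ (s : ℤ) - (t : ℤ) := by
      simpa using hst
    obtain ⟨hdvd', -⟩ : (n : ℤ) ∣ k - ((s' : ℤ) - (t' : ℤ)) ∧ k ≠ (s' : ℤ) - (t' : ℤ) := by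
      simpa using hst'
    have htt' : (t : ℕ) = t' := by
      simp only at heq
      split_ifs at heq <;> omega
    have := Int.eq_zero_of_abs_lt_dvd (dvd_sub hdvd hdvd') (by rw [abs_lt]; omega)
    exact Prod.ext (Fin.ext (by simp only; omega)) (Fin.ext htt')

lemma summable_ite_abs (hγ : Summable fun k => |γ k|) (p : ℤ → Prop) [DecidablePred p] :
    Summable fun k => if p k then |γ k| else 0 :=
  hγ.of_nonneg_of_le (fun k => by split_ifs <;> simp) fun k => by split_ifs <;> simp

lemma sq_sub_aliasedCov_le (hγ : Summable fun k => |γ k|) (n : ℕ) (h : ℤ) :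
    (γ h - aliasedCov γ n h) ^ 2
      ≤ (∑' k, |γ k|) * ∑' k, if (n : ℤ) ∣ k - h ∧ k ≠ h then |γ k| else 0 := by
  have hsum (p : ℤ → Prop) [DecidablePred p] : Summable fun k => if p k then γ k else 0 :=
    Summable.of_norm_bounded hγ fun k => by split_ifs <;> simp
  have hdiff : aliasedCov γ n h - γ h
      = ∑' k, if (n : ℤ) ∣ k - h ∧ k ≠ h then γ k else 0 := by
    rw [aliasedCov, ← tsum_ite_eq_apply (γ := γ) h, ← (hsum _).tsum_sub (hsum _)]
    refine tsum_congr fun k => ?_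
    by_cases hk : k = h <;> simp [hk]
  have habs : |aliasedCov γ n h - γ h|
      ≤ ∑' k, if (n : ℤ) ∣ k - h ∧ k ≠ h then |γ k| else 0 := by
    rw [hdiff, ← Real.norm_eq_abs]
    refine tsum_of_norm_bounded (summable_ite_abs hγ _).hasSum fun k => ?_
    split_ifs <;> simp
  have htail : ∑' k, (if (n : ℤ) ∣ k - h ∧ k ≠ h then |γ k| else 0) ≤ ∑' k, |γ k| :=
    (summable_ite_abs hγ _).tsum_le_tsum (fun k => by split_ifs <;> simp) hγ
  rw [← neg_sq, neg_sub, ← sq_abs, sq]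
  exact mul_le_mul (habs.trans htail) habs (abs_nonneg _) (tsum_nonneg fun k => abs_nonneg _)

lemma sum_sq_toeplitz_sub_fourierMultiplier_le (hγ : Summable fun k => |γ k|)
    (hγ' : Summable fun k : ℤ => |(k : ℝ)| * |γ k|) (heven : ∀ k, γ (-k) = γ k) (n : ℕ) :
    ∑ s, ∑ t,
        (toeplitz γ n - fourierMultiplier (fun x => 2 * Real.pi * spectralDensity γ x) n) s t ^ 2
      ≤ (∑' k, |γ k|) * ∑' k : ℤ, |(k : ℝ)| * |γ k| := by
  simp only [Matrix.sub_apply, fourierMultiplier_spectralDensity_apply hγ heven]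
  calc ∑ s : Fin n, ∑ t : Fin n,
        (γ ((s : ℤ) - (t : ℤ)) - aliasedCov γ n ((s : ℤ) - (t : ℤ))) ^ 2
    _ ≤ ∑ s : Fin n, ∑ t : Fin n, (∑' k, |γ k|) * ∑' k : ℤ,
        if (n : ℤ) ∣ k - ((s : ℤ) - (t : ℤ)) ∧ k ≠ (s : ℤ) - (t : ℤ) then |γ k| else 0 :=
      Finset.sum_le_sum fun s _ => Finset.sum_le_sum fun t _ => sq_sub_aliasedCov_le hγ n _
    _ = (∑' k, |γ k|) * ∑' k : ℤ, ∑ p : Fin n × Fin n,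
        if (n : ℤ) ∣ k - ((p.1 : ℤ) - (p.2 : ℤ)) ∧ k ≠ (p.1 : ℤ) - (p.2 : ℤ)
          then |γ k| else 0 := by
      rw [Summable.tsum_finsetSum fun p _ => summable_ite_abs hγ _, ← Fintype.sum_prod_type',
        Finset.mul_sum]
    _ ≤ (∑' k, |γ k|) * ∑' k : ℤ, |(k : ℝ)| * |γ k| := by
      refine mul_le_mul_of_nonneg_left ?_ (tsum_nonneg fun k => abs_nonneg _)
      refine (summable_sum fun p _ => summable_ite_abs hγ _).tsum_le_tsum (fun k => ?_) hγ'
      rw [← Finset.sum_filter, Finset.sum_const, nsmul_eq_mul, ← Int.cast_abs, Int.abs_eq_natAbs]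
      gcongr
      exact_mod_cast card_aliased_le n k

end Toeplitz

/-! ### Whitening and simultaneous diagonalization -/

section Orthogonal

variable {ι : Type*} [Fintype ι]

lemma trace_mul_transpose_self (X : Matrix ι ι ℝ) : (X * Xᵀ).trace = ∑ i, ∑ j, X i j ^ 2 := by
  simp only [Matrix.trace, Matrix.diag_apply, Matrix.mul_apply, Matrix.transpose_apply, sq]

variable [DecidableEq ι] {U S : Matrix ι ι ℝ} {l : ι → ℝ}

lemma sum_sq_conj (hU : Uᵀ * U = 1) (X : Matrix ι ι ℝ) :
    ∑ i, ∑ j, (U * X * Uᵀ) i j ^ 2 = ∑ i, ∑ j, X i j ^ 2 := by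
  have hmul : U * X * Uᵀ * (U * X * Uᵀ)ᵀ = U * (X * (Uᵀ * U) * Xᵀ * Uᵀ) := by
    simp only [Matrix.transpose_mul, Matrix.transpose_transpose, Matrix.mul_assoc]
  rw [← trace_mul_transpose_self, ← trace_mul_transpose_self, hmul, hU, Matrix.mul_one,
    Matrix.trace_mul_comm, Matrix.mul_assoc, hU, Matrix.mul_one]

lemma exists_orthogonal_diagonalization (hS : S.IsHermitian) :
    ∃ (U : Matrix ι ι ℝ) (l : ι → ℝ), Uᵀ * U = 1 ∧ U * S * Uᵀ = Matrix.diagonal l := by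
  set W : Matrix ι ι ℝ := hS.eigenvectorUnitary.1
  have hstar : star W = Wᵀ := Matrix.conjTranspose_eq_transpose_of_trivial W
  have hWW : Wᵀ * W = 1 := hstar ▸ Unitary.coe_star_mul_self hS.eigenvectorUnitary
  have hSW : S = W * Matrix.diagonal hS.eigenvalues * Wᵀ := hstar ▸ hS.spectral_theorem
  refine ⟨Wᵀ, hS.eigenvalues, ?_, ?_⟩
  · rw [Matrix.transpose_transpose, mul_eq_one_comm.1 hWW]
  · calc Wᵀ * S * Wᵀᵀ = Wᵀ * (W * Matrix.diagonal hS.eigenvalues * Wᵀ) * W := by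
          rw [← hSW, Matrix.transpose_transpose]
      _ = Wᵀ * W * Matrix.diagonal hS.eigenvalues * (Wᵀ * W) := by
          simp only [Matrix.mul_assoc]
      _ = Matrix.diagonal hS.eigenvalues := by rw [hWW, Matrix.one_mul, Matrix.mul_one]

lemma conj_sub_smul_one (hU : Uᵀ * U = 1) (hl : U * S * Uᵀ = Matrix.diagonal l) (c : ℝ) :
    U * (S - c • 1) * Uᵀ = Matrix.diagonal fun i => l i - c := by
  rw [Matrix.mul_sub, Matrix.sub_mul, hl, Matrix.mul_smul, Matrix.smul_mul, Matrix.mul_one,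
    mul_eq_one_comm.1 hU, Matrix.smul_one_eq_diagonal, Matrix.diagonal_sub]

lemma le_of_posSemidef_sub (hU : Uᵀ * U = 1) (hl : U * S * Uᵀ = Matrix.diagonal l) {a : ℝ}
    (hS : (S - a • 1).PosSemidef) (i : ι) : a ≤ l i := by
  have hpos := (hS.mul_mul_conjTranspose_same U).diag_nonneg (i := i)
  rwa [Matrix.conjTranspose_eq_transpose_of_trivial, conj_sub_smul_one hU hl,
    Matrix.diagonal_apply_eq, sub_nonneg] at hpos

lemma sum_sq_sub_one_eq (hU : Uᵀ * U = 1) (hl : U * S * Uᵀ = Matrix.diagonal l) :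
    ∑ i, (l i - 1) ^ 2 = ∑ i, ∑ j, (S - 1) i j ^ 2 := by
  have hconj := conj_sub_smul_one hU hl 1
  rw [one_smul] at hconj
  rw [← sum_sq_conj hU, hconj]
  refine Finset.sum_congr rfl fun i _ => ?_
  rw [Finset.sum_eq_single i (fun j _ hji => by simp [Matrix.diagonal_apply_ne _ hji.symm])
    (by simp), Matrix.diagonal_apply_eq]

end Orthogonal

lemma sum_sq_fourierMultiplier_mul_mul_le {n : ℕ} {g : ℝ → ℝ} {c : ℝ}
    (hg : ∀ x ∈ Set.Icc 0 Real.pi, g x ^ 2 ≤ c) (X : Matrix (Fin n) (Fin n) ℝ) :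
    ∑ i, ∑ j, (fourierMultiplier g n * X * fourierMultiplier g n) i j ^ 2
      ≤ c ^ 2 * ∑ i, ∑ j, X i j ^ 2 := by
  set F := fourierMatrix n
  set E := Matrix.diagonal (freqDiag g n)
  have hF : Fᵀ * F = 1 := fourierMatrix_transpose_mul_self
  have hF' : Fᵀᵀ * Fᵀ = 1 := by rw [Matrix.transpose_transpose, fourierMatrix_mul_transpose_self]
  have hconj : fourierMultiplier g n * X * fourierMultiplier g n
      = Fᵀ * (E * (F * X * Fᵀ) * E) * Fᵀᵀ := by
    simp only [fourierMultiplier, Matrix.transpose_transpose, Matrix.mul_assoc, F, E]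
  rw [hconj, sum_sq_conj hF', ← sum_sq_conj hF X, Finset.mul_sum]
  refine Finset.sum_le_sum fun i _ => ?_
  rw [Finset.mul_sum]
  refine Finset.sum_le_sum fun j _ => ?_
  have hi : freqDiag g n i ^ 2 ≤ c := hg _ (fourierFreq_half_mem_Icc i)
  have hj : freqDiag g n j ^ 2 ≤ c := hg _ (fourierFreq_half_mem_Icc j)
  calc (E * (F * X * Fᵀ) * E) i j ^ 2
      = freqDiag g n i ^ 2 * freqDiag g n j ^ 2 * (F * X * Fᵀ) i j ^ 2 := by
        rw [Matrix.mul_diagonal, Matrix.diagonal_mul]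
        ring
    _ ≤ c ^ 2 * (F * X * Fᵀ) i j ^ 2 := by
        rw [sq c]
        gcongr
        exact (sq_nonneg _).trans hi

section Whitening

variable {f : ℝ → ℝ} {n : ℕ}

/-- The symmetric square root of the inverse of the circulant matrix with symbol `2πf`. It
standardizes the Whittle law with spectral density `f`. -/
noncomputable def whiteningMatrix (f : ℝ → ℝ) (n : ℕ) : Matrix (Fin n) (Fin n) ℝ :=
  fourierMultiplier (fun x => (2 * Real.pi * f x) ^ (-(1 / 2) : ℝ)) n

lemma whiteningMatrix_transpose : (whiteningMatrix f n)ᵀ = whiteningMatrix f n :=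
  fourierMultiplier_transpose _ n

lemma rpow_neg_half_sq {x : ℝ} (hx : 0 < x) : (x ^ (-(1 / 2) : ℝ)) ^ 2 = x⁻¹ := by
  rw [← Real.rpow_mul_natCast hx.le, ← Real.rpow_neg_one]
  norm_num

lemma isUnit_whiteningMatrix (hf : ∀ x ∈ Set.Icc 0 Real.pi, 0 < f x) :
    IsUnit (whiteningMatrix f n) :=
  isUnit_fourierMultiplier fun x hx =>
    (Real.rpow_pos_of_pos (mul_pos Real.two_pi_pos (hf x hx)) _).ne'

lemma whiteningMatrix_mul_self (hf : ∀ x ∈ Set.Icc 0 Real.pi, 0 < f x) :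
    whiteningMatrix f n * whiteningMatrix f n
      = fourierMultiplier (fun x => (2 * Real.pi * f x)⁻¹) n := by
  rw [whiteningMatrix, fourierMultiplier_mul]
  refine fourierMultiplier_congr fun x hx => ?_
  rw [← sq, rpow_neg_half_sq (mul_pos Real.two_pi_pos (hf x hx))]

lemma whiteningMatrix_mul_fourierMultiplier_mul (hf : ∀ x ∈ Set.Icc 0 Real.pi, 0 < f x) :
    whiteningMatrix f n * fourierMultiplier (fun x => 2 * Real.pi * f x) n * whiteningMatrix f n
      = 1 := by
  rw [whiteningMatrix, fourierMultiplier_mul, fourierMultiplier_mul,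
    fourierMultiplier_congr (h := fun _ => 1) fun x hx => ?_, fourierMultiplier_const, one_smul]
  have hpos : 0 < 2 * Real.pi * f x := mul_pos Real.two_pi_pos (hf x hx)
  rw [mul_right_comm, ← sq, rpow_neg_half_sq hpos, inv_mul_cancel₀ hpos.ne']

lemma posSemidef_whitening_mul_mul_sub {T : Matrix (Fin n) (Fin n) ℝ} {b G : ℝ} (hb : 0 < b)
    (hT : (T - b • 1).PosSemidef) (hf : ∀ x ∈ Set.Icc 0 Real.pi, 0 < f x)
    (hG : ∀ x ∈ Set.Icc 0 Real.pi, 2 * Real.pi * f x ≤ G) :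
    (whiteningMatrix f n * T * whiteningMatrix f n - (b / G) • 1).PosSemidef := by
  set A := whiteningMatrix f n with hA
  have hTA : (A * (T - b • 1) * A).PosSemidef := by
    have := hT.conjTranspose_mul_mul_same A
    rwa [Matrix.conjTranspose_eq_transpose_of_trivial, hA, whiteningMatrix_transpose] at this
  have hAA : (A * A - G⁻¹ • 1).PosSemidef := by
    rw [hA, whiteningMatrix_mul_self hf, ← fourierMultiplier_const, ← fourierMultiplier_sub]
    exact posSemidef_fourierMultiplier fun x hx =>
      sub_nonneg.2 (inv_anti₀ (mul_pos Real.two_pi_pos (hf x hx)) (hG x hx))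
  have hsplit : A * T * A - (b / G) • 1 = A * (T - b • 1) * A + b • (A * A - G⁻¹ • 1) := by
    rw [Matrix.mul_sub, Matrix.sub_mul, Matrix.mul_smul, Matrix.mul_one, Matrix.smul_mul, smul_sub,
      smul_smul, div_eq_mul_inv]
    abel
  rw [hsplit]
  exact hTA.add (hAA.smul hb.le)

lemma sum_sq_whitening_mul_mul_sub_one_le (T : Matrix (Fin n) (Fin n) ℝ) {b : ℝ} (hb : 0 < b)
    (hf : ∀ x ∈ Set.Icc 0 Real.pi, b ≤ 2 * Real.pi * f x) :
    ∑ i, ∑ j, (whiteningMatrix f n * T * whiteningMatrix f n - 1) i j ^ 2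
      ≤ b⁻¹ ^ 2 * ∑ i, ∑ j, (T - fourierMultiplier (fun x => 2 * Real.pi * f x) n) i j ^ 2 := by
  have hpos (x : ℝ) (hx : x ∈ Set.Icc 0 Real.pi) : 0 < f x :=
    pos_of_mul_pos_right (hb.trans_le (hf x hx)) Real.two_pi_pos.le
  rw [← whiteningMatrix_mul_fourierMultiplier_mul hpos, ← Matrix.sub_mul, ← Matrix.mul_sub]
  refine sum_sq_fourierMultiplier_mul_mul_le (fun x hx => ?_) _
  rw [rpow_neg_half_sq (mul_pos Real.two_pi_pos (hpos x hx))]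
  exact inv_anti₀ hb (hf x hx)

end Whitening

lemma ShortMemory.exists_eigenvalue_bounds {γ : ℤ → ℝ} (hγ : ShortMemory γ)
    (heven : ∀ k, γ (-k) = γ k) :
    ∃ a K : ℝ, 0 < a ∧ ∀ n, ∃ (U : Matrix (Fin n) (Fin n) ℝ) (l : Fin n → ℝ), Uᵀ * U = 1 ∧
      U * whiteningMatrix (spectralDensity γ) n * toeplitz γ n
        * (U * whiteningMatrix (spectralDensity γ) n)ᵀ = Matrix.diagonal l ∧
      (∀ i, a ≤ l i) ∧ ∑ i, (l i - 1) ^ 2 ≤ K := by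
  have hsum := hγ.summable_abs
  obtain ⟨b, hb, hle⟩ := hγ.exists_le_two_pi_mul
  set G := ∑' k, |γ k|
  have hG (x : ℝ) : 2 * Real.pi * spectralDensity γ x ≤ G := two_pi_mul_spectralDensity_le hsum x
  have hG0 : 0 < G := hb.trans_le ((hle 0 ⟨le_rfl, Real.pi_pos.le⟩).trans (hG 0))
  refine ⟨b / G, b⁻¹ ^ 2 * (G * ∑' k : ℤ, |(k : ℝ)| * |γ k|), by positivity, fun n => ?_⟩
  set A := whiteningMatrix (spectralDensity γ) n
  have hAt : Aᵀ = A := whiteningMatrix_transpose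
  have hS : (A * toeplitz γ n * A).IsHermitian := by
    rw [Matrix.IsHermitian, Matrix.conjTranspose_eq_transpose_of_trivial, Matrix.transpose_mul,
      Matrix.transpose_mul, hAt, toeplitz_transpose heven, Matrix.mul_assoc]
  obtain ⟨U, l, hU, hl⟩ := exists_orthogonal_diagonalization hS
  refine ⟨U, l, hU, ?_, ?_, ?_⟩
  · rw [← hl, Matrix.transpose_mul, hAt]
    simp only [Matrix.mul_assoc]
  · exact le_of_posSemidef_sub hU hl <| posSemidef_whitening_mul_mul_sub hb
      (posSemidef_toeplitz_sub hsum heven hle n) (fun x => hγ.spectralDensity_pos) fun x _ => hG x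
  · rw [sum_sq_sub_one_eq hU hl]
    refine (sum_sq_whitening_mul_mul_sub_one_le _ hb hle).trans ?_
    gcongr
    exact sum_sq_toeplitz_sub_fourierMultiplier_le hsum hγ.summable_abs_mul heven n

/-! ### The Whittle law -/

section WhittleLaw

variable {n : ℕ} {f : ℝ → ℝ}

lemma two_pi_mul_periodogram (z : Fin n → ℝ) (x : ℝ) :
    2 * Real.pi * periodogram n z x
      = (n : ℝ)⁻¹ * ∑ s, ∑ t, z s * z t * Real.cos (((s : ℤ) - (t : ℤ) : ℤ) * x) := by
  have hexp (t : Fin n) : -Complex.I * ((t : ℕ) + 1 : ℂ) * (x : ℂ)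
      = ((-(((t : ℕ) + 1) * x) : ℝ) : ℂ) * Complex.I := by
    push_cast
    ring
  have hcos (s t : Fin n) : Real.cos (((s : ℤ) - (t : ℤ) : ℤ) * x)
      = Real.cos (((s : ℕ) + 1) * x - ((t : ℕ) + 1) * x) := by
    congr 1
    push_cast
    ring
  have hpi : 2 * Real.pi * (1 / (2 * Real.pi * n)) = (n : ℝ)⁻¹ := by
    rw [one_div, mul_inv, mul_inv_cancel_left₀ Real.two_pi_pos.ne']
  rw [periodogram, ← mul_assoc, hpi, Complex.sq_norm, Complex.normSq_apply, Complex.re_sum,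
    Complex.im_sum, Finset.sum_mul_sum, Finset.sum_mul_sum, ← Finset.sum_add_distrib]
  simp only [← Finset.sum_add_distrib, hexp, hcos, Complex.re_ofReal_mul, Complex.im_ofReal_mul,
    Complex.exp_ofReal_mul_I_re, Complex.exp_ofReal_mul_I_im, Real.cos_neg, Real.sin_neg,
    Real.cos_sub]
  congr! 3
  ring

lemma sum_periodogram_div (hf : ∀ x, f (2 * Real.pi - x) = f x) (z : Fin n → ℝ) :
    ∑ j ∈ Finset.range n, periodogram n z (fourierFreq n j) / f (fourierFreq n j)
      = z ⬝ᵥ (fourierMultiplier (fun x => (2 * Real.pi * f x)⁻¹) n *ᵥ z) := by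
  have hterm (j : ℕ) : periodogram n z (fourierFreq n j) / f (fourierFreq n j)
      = ∑ s, ∑ t, (n : ℝ)⁻¹ * (z s * z t * ((2 * Real.pi * f (fourierFreq n j))⁻¹
        * Real.cos (((s : ℤ) - (t : ℤ) : ℤ) * fourierFreq n j))) := by
    rw [← mul_div_mul_left _ _ Real.two_pi_pos.ne', two_pi_mul_periodogram, div_eq_mul_inv]
    simp only [Finset.mul_sum, Finset.sum_mul]
    congr! 2
    ring
  simp only [hterm]
  rw [Finset.sum_comm, dotProduct]
  refine Finset.sum_congr rfl fun s _ => ?_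
  rw [Finset.sum_comm, Matrix.mulVec, dotProduct, Finset.mul_sum]
  refine Finset.sum_congr rfl fun t _ => ?_
  rw [fourierMultiplier_apply fun x => by rw [hf], ← Finset.mul_sum, ← Finset.mul_sum]
  ring

lemma whittleLaw_eq_normalizedLaw (hf : ∀ x, f (2 * Real.pi - x) = f x)
    (hpos : ∀ x ∈ Set.Icc 0 Real.pi, 0 < f x) :
    whittleLaw f n = normalizedLaw fun z => gaussianKernel (whiteningMatrix f n *ᵥ z) := by
  have hm : Measurable fun z => gaussianKernel (whiteningMatrix f n *ᵥ z) :=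
    measurable_gaussianKernel.comp
      (measurableEmbedding_mulVec (isUnit_whiteningMatrix hpos)).measurable
  set c := Real.exp (-(1 / 2) * ∑ j ∈ Finset.range n, Real.log (f (fourierFreq n j)))
  have hc : ENNReal.ofReal c ≠ 0 := by simpa using Real.exp_pos _
  rw [← normalizedLaw_const_mul hc ENNReal.ofReal_ne_top hm, whittleLaw]
  congr 1
  ext z
  rw [gaussianKernel, ← ENNReal.ofReal_mul (Real.exp_pos _).le, ← Real.exp_add, ← mul_add,
    Finset.sum_add_distrib, sum_periodogram_div hf, ← whiteningMatrix_mul_self hpos,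
    ← Matrix.mulVec_mulVec, Matrix.dotProduct_mulVec, ← Matrix.mulVec_transpose,
    whiteningMatrix_transpose]

lemma whittleLaw_absolutelyContinuous : whittleLaw f n ≪ volume :=
  (withDensity_absolutelyContinuous _ _).smul_left _

lemma map_mulVec_whittleLaw (hf : ∀ x, f (2 * Real.pi - x) = f x)
    (hpos : ∀ x ∈ Set.Icc 0 Real.pi, 0 < f x) {U : Matrix (Fin n) (Fin n) ℝ} (hU : Uᵀ * U = 1) :
    (whittleLaw f n).map (fun z => (U * whiteningMatrix f n) *ᵥ z)
      = Measure.pi fun _ => gaussianReal 0 1 := by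
  have hunit : IsUnit (U * whiteningMatrix f n) :=
    (IsUnit.of_mul_eq_one_right Uᵀ hU).mul (isUnit_whiteningMatrix hpos)
  rw [← normalizedLaw_gaussianKernel, ← map_normalizedLaw_mulVec hunit measurable_gaussianKernel,
    whittleLaw_eq_normalizedLaw hf hpos]
  simp only [← Matrix.mulVec_mulVec, gaussianKernel_mulVec_of_transpose_mul_self hU]

end WhittleLaw

/-! ### The law of the series -/

section GaussianVector

variable {Ω ι κ : Type*} [MeasurableSpace Ω] [Fintype ι] {P : Measure Ω} {X : Ω → ι → ℝ}
  {Γ : Matrix ι ι ℝ}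

lemma covariance_mulVec_apply [IsFiniteMeasure P] (hX : ∀ i, MemLp (fun ω => X ω i) 2 P)
    (hΓ : ∀ i j, cov[fun ω => X ω i, fun ω => X ω j; P] = Γ i j) (L : Matrix κ ι ℝ) (i j : κ) :
    cov[fun ω => (L *ᵥ X ω) i, fun ω => (L *ᵥ X ω) j; P] = (L * Γ * Lᵀ) i j := by
  simp only [Matrix.mulVec, dotProduct]
  rw [covariance_fun_sum_fun_sum (fun t => (hX t).const_mul _) fun t => (hX t).const_mul _,
    Matrix.mul_apply, Finset.sum_comm]
  simp only [covariance_const_mul_left, covariance_const_mul_right, hΓ, Matrix.mul_apply,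
    Finset.sum_mul, Matrix.transpose_apply]
  congr! 2
  ring

variable [Fintype κ] [DecidableEq κ]

lemma map_mulVec_eq_pi_gaussianReal (hX : HasGaussianLaw X P)
    (hmean : ∀ i, ∫ ω, X ω i ∂P = 0) (hΓ : ∀ i j, cov[fun ω => X ω i, fun ω => X ω j; P] = Γ i j)
    {L : Matrix κ ι ℝ} {l : κ → ℝ} (hL : L * Γ * Lᵀ = Matrix.diagonal l) :
    P.map (fun ω => L *ᵥ X ω) = Measure.pi fun i => gaussianReal 0 (l i).toNNReal := by
  have := hX.isProbabilityMeasure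
  have hmem (i : ι) : MemLp (fun ω => X ω i) 2 P := (hX.eval i).memLp_two
  have hlaw : HasGaussianLaw (fun ω i => (L *ᵥ X ω) i) P :=
    hX.map (LinearMap.toContinuousLinearMap (Matrix.mulVecLin L))
  have hcov (i j : κ) : cov[fun ω => (L *ᵥ X ω) i, fun ω => (L *ᵥ X ω) j; P]
      = Matrix.diagonal l i j := by
    rw [covariance_mulVec_apply hmem hΓ, hL]
  have hzero (i : κ) : ∫ ω, (L *ᵥ X ω) i ∂P = 0 := by
    simp only [Matrix.mulVec, dotProduct]
    rw [integral_finsetSum _ fun t _ => ((hmem t).integrable one_le_two).const_mul _]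
    exact Finset.sum_eq_zero fun t _ => by rw [integral_const_mul, hmean, mul_zero]
  have hmeas (i : κ) : AEMeasurable (fun ω => (L *ᵥ X ω) i) P := (hlaw.eval i).aemeasurable
  have hindep : iIndepFun (fun i ω => (L *ᵥ X ω) i) P :=
    hlaw.iIndepFun_of_covariance_eq_zero fun i j hij => by
      rw [hcov, Matrix.diagonal_apply_ne _ hij]
  refine ((iIndepFun_iff_map_fun_eq_pi_map hmeas).1 hindep).trans ?_
  congr 1
  ext1 i
  rw [(hlaw.eval i).map_eq_gaussianReal, hzero, ← covariance_self (hmeas i), hcov,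
    Matrix.diagonal_apply_eq]

end GaussianVector

section Series

variable {Ω : Type*} [MeasurableSpace Ω] {P : Measure Ω} {Z : ℕ → Ω → ℝ} {γ : ℤ → ℝ}

lemma IsStationaryGaussianSeries.even (hZ : IsStationaryGaussianSeries P Z γ) (k : ℤ) :
    γ (-k) = γ k := by
  have hcomm (s t : ℕ) : γ ((s : ℤ) - t) = γ ((t : ℤ) - s) := by
    rw [← hZ.autocov, ← hZ.autocov, covariance_comm]
  obtain ⟨m, rfl | rfl⟩ := k.eq_nat_or_neg
  · simpa using hcomm 0 m
  · simpa using hcomm m 0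

lemma IsStationaryGaussianSeries.hasGaussianLaw (hZ : IsStationaryGaussianSeries P Z γ) (n : ℕ) :
    HasGaussianLaw (fun ω (t : Fin n) => Z ((t : ℕ) + 1) ω) P :=
  (hZ.gaussian.hasGaussianLaw (Finset.range (n + 1))).map
    (ContinuousLinearMap.pi fun t : Fin n =>
      ContinuousLinearMap.proj (R := ℝ) (φ := fun _ : Finset.range (n + 1) => ℝ)
        ⟨(t : ℕ) + 1, by simp⟩)

lemma IsStationaryGaussianSeries.isProbabilityMeasure_seriesLaw
    (hZ : IsStationaryGaussianSeries P Z γ) (n : ℕ) : IsProbabilityMeasure (seriesLaw P Z n) :=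
  have := hZ.gaussian.isProbabilityMeasure
  Measure.isProbabilityMeasure_map (hZ.hasGaussianLaw n).aemeasurable

lemma IsStationaryGaussianSeries.map_mulVec_seriesLaw (hZ : IsStationaryGaussianSeries P Z γ)
    {n : ℕ} {L : Matrix (Fin n) (Fin n) ℝ} {l : Fin n → ℝ}
    (hL : L * toeplitz γ n * Lᵀ = Matrix.diagonal l) :
    (seriesLaw P Z n).map (fun z => L *ᵥ z)
      = Measure.pi fun i => gaussianReal 0 (l i).toNNReal := by
  have hm : Measurable fun z : Fin n → ℝ => L *ᵥ z :=
    (Continuous.matrix_mulVec continuous_const continuous_id).measurable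
  rw [seriesLaw, AEMeasurable.map_map_of_aemeasurable hm.aemeasurable
    (hZ.hasGaussianLaw n).aemeasurable]
  refine map_mulVec_eq_pi_gaussianReal (hZ.hasGaussianLaw n) (fun t => hZ.mean_zero _)
    (fun s t => ?_) hL
  rw [hZ.autocov, ← hZ.even, toeplitz, Matrix.of_apply]
  congr 1
  push_cast
  ring

lemma inv_sub_one_sq_le {a x : ℝ} (ha : 0 < a) (hax : a ≤ x) :
    (x⁻¹ - 1) ^ 2 ≤ (x - 1) ^ 2 / a ^ 2 := by
  have hx : x ≠ 0 := (ha.trans_le hax).ne'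
  calc (x⁻¹ - 1) ^ 2 = (x - 1) ^ 2 / x ^ 2 := by
        field_simp
        ring
    _ ≤ (x - 1) ^ 2 / a ^ 2 := by gcongr

lemma IsStationaryGaussianSeries.exists_map_eq_pi (hZ : IsStationaryGaussianSeries P Z γ)
    (hγ : ShortMemory γ) :
    ∃ a K : ℝ, 0 < a ∧ ∃ (e : ∀ n, (Fin n → ℝ) → Fin n → ℝ) (l : ∀ n, Fin n → ℝ),
      (∀ n, MeasurableEmbedding (e n)) ∧
      (∀ n, (seriesLaw P Z n).map (e n) = Measure.pi fun i => gaussianReal 0 (l n i).toNNReal) ∧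
      (∀ n, (whittleLaw (spectralDensity γ) n).map (e n) = Measure.pi fun _ => gaussianReal 0 1) ∧
      (∀ n i, a ≤ l n i) ∧ ∀ n, ∑ i, (l n i - 1) ^ 2 ≤ K := by
  obtain ⟨a, K, ha, hdiag⟩ := hγ.exists_eigenvalue_bounds hZ.even
  choose U l hU hl hal hK using hdiag
  refine ⟨a, K, ha, fun n z => (U n * whiteningMatrix (spectralDensity γ) n) *ᵥ z, l,
    fun n => measurableEmbedding_mulVec ?_, fun n => hZ.map_mulVec_seriesLaw (hl n), fun n => ?_,
    hal, hK⟩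
  · exact (IsUnit.of_mul_eq_one_right _ (hU n)).mul
      (isUnit_whiteningMatrix fun x => hγ.spectralDensity_pos)
  · exact map_mulVec_whittleLaw (spectralDensity_two_pi_sub hγ.summable_abs)
      (fun x => hγ.spectralDensity_pos) (hU n)

lemma IsStationaryGaussianSeries.powerDominated_seriesLaw_whittleLaw
    (hZ : IsStationaryGaussianSeries P Z γ) (hγ : ShortMemory γ) :
    PowerDominated (fun n => seriesLaw P Z n) fun n => whittleLaw (spectralDensity γ) n := by
  obtain ⟨a, K, ha, e, l, he, hseries, hwhittle, hal, hK⟩ := hZ.exists_map_eq_pi hγ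
  have hcoe (n : ℕ) (i : Fin n) : ((l n i).toNNReal : ℝ) / (1 : ℝ≥0) = l n i := by
    rw [Real.coe_toNNReal _ (ha.le.trans (hal n i)), NNReal.coe_one, div_one]
  refine .of_map he ?_
  simp only [hseries, hwhittle]
  refine powerDominated_pi_gaussianReal (fun _ _ => 0) (K := K) ha (fun n i => ?_) fun n => ?_
  · rw [hcoe]
    exact hal n i
  · simp only [hcoe]
    exact hK n

lemma IsStationaryGaussianSeries.powerDominated_whittleLaw_seriesLaw
    (hZ : IsStationaryGaussianSeries P Z γ) (hγ : ShortMemory γ) :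
    PowerDominated (fun n => whittleLaw (spectralDensity γ) n) fun n => seriesLaw P Z n := by
  obtain ⟨a, K, ha, e, l, he, hseries, hwhittle, hal, hK⟩ := hZ.exists_map_eq_pi hγ
  have hcoe (n : ℕ) (i : Fin n) : ((1 : ℝ≥0) : ℝ) / (l n i).toNNReal = (l n i)⁻¹ := by
    rw [Real.coe_toNNReal _ (ha.le.trans (hal n i)), NNReal.coe_one, one_div]
  have hK0 : 0 ≤ K := (Finset.sum_nonneg fun i _ => sq_nonneg _).trans (hK 0)
  refine .of_map he ?_
  simp only [hseries, hwhittle]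
  refine powerDominated_pi_gaussianReal (fun _ _ => 0) (a := (K + 2)⁻¹) (K := K / a ^ 2)
    (by positivity) (fun n i => ?_) fun n => ?_
  · have hlK : (l n i - 1) ^ 2 ≤ K :=
      (Finset.single_le_sum (f := fun i => (l n i - 1) ^ 2) (fun i _ => sq_nonneg _)
        (Finset.mem_univ i)).trans (hK n)
    rw [hcoe]
    exact inv_anti₀ (ha.trans_le (hal n i)) (by nlinarith)
  · simp only [hcoe]
    calc ∑ i, ((l n i)⁻¹ - 1) ^ 2 ≤ ∑ i, (l n i - 1) ^ 2 / a ^ 2 :=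
          Finset.sum_le_sum fun i _ => inv_sub_one_sq_le ha (hal n i)
      _ = (∑ i, (l n i - 1) ^ 2) / a ^ 2 := (Finset.sum_div ..).symm
      _ ≤ K / a ^ 2 := by
          gcongr
          exact hK n

lemma IsStationaryGaussianSeries.seriesLaw_absolutelyContinuous
    (hZ : IsStationaryGaussianSeries P Z γ) (hγ : ShortMemory γ) (n : ℕ) :
    seriesLaw P Z n ≪ volume :=
  ((hZ.powerDominated_seriesLaw_whittleLaw hγ).absolutelyContinuous n).trans
    whittleLaw_absolutelyContinuous

lemma IsStationaryGaussianSeries.normalizedLaw_seriesDensity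
    (hZ : IsStationaryGaussianSeries P Z γ) (hγ : ShortMemory γ) (n : ℕ) :
    normalizedLaw (seriesDensity P Z n) = seriesLaw P Z n :=
  have := hZ.isProbabilityMeasure_seriesLaw n
  normalizedLaw_of_withDensity_eq
    (Measure.withDensity_rnDeriv_eq _ _ (hZ.seriesLaw_absolutelyContinuous hγ n))

end Series

/-! ### The corrected law -/

section CorrectedLaw

variable {n : ℕ} {f fparam : ℝ → ℝ}

lemma whiteningMatrix_mul_correction (hf : ∀ x ∈ Set.Icc 0 Real.pi, 0 < f x)
    (hfparam : ∀ x ∈ Set.Icc 0 Real.pi, 0 < fparam x) :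
    whiteningMatrix fparam n * fourierMultiplier (fun x => (f x / fparam x) ^ (-(1 / 2) : ℝ)) n
      = whiteningMatrix f n := by
  rw [whiteningMatrix, fourierMultiplier_mul]
  refine fourierMultiplier_congr fun x hx => ?_
  have hx' := hf x hx
  have hx'' := hfparam x hx
  rw [← Real.mul_rpow (by positivity) (by positivity)]
  congr 1
  field_simp

lemma isUnit_correction (hf : ∀ x ∈ Set.Icc 0 Real.pi, 0 < f x)
    (hfparam : ∀ x ∈ Set.Icc 0 Real.pi, 0 < fparam x) :
    IsUnit (fourierMultiplier (fun x => (f x / fparam x) ^ (-(1 / 2) : ℝ)) n) :=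
  isUnit_fourierMultiplier fun x hx =>
    (Real.rpow_pos_of_pos (div_pos (hf x hx) (hfparam x hx)) _).ne'

lemma map_correction_whittleLaw (hf : ∀ x ∈ Set.Icc 0 Real.pi, 0 < f x)
    (hfparam : ∀ x ∈ Set.Icc 0 Real.pi, 0 < fparam x) (hfs : ∀ x, f (2 * Real.pi - x) = f x)
    (hfps : ∀ x, fparam (2 * Real.pi - x) = fparam x) :
    (whittleLaw f n).map
        (fun z => fourierMultiplier (fun x => (f x / fparam x) ^ (-(1 / 2) : ℝ)) n *ᵥ z)
      = whittleLaw fparam n := by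
  have hm : Measurable fun z => gaussianKernel (whiteningMatrix fparam n *ᵥ z) :=
    measurable_gaussianKernel.comp
      (measurableEmbedding_mulVec (isUnit_whiteningMatrix hfparam)).measurable
  rw [whittleLaw_eq_normalizedLaw hfs hf, whittleLaw_eq_normalizedLaw hfps hfparam,
    ← map_normalizedLaw_mulVec (isUnit_correction hf hfparam) hm]
  simp only [Matrix.mulVec_mulVec, whiteningMatrix_mul_correction hf hfparam]

lemma map_correction_correctedLaw (hf : ∀ x ∈ Set.Icc 0 Real.pi, 0 < f x)
    (hfparam : ∀ x ∈ Set.Icc 0 Real.pi, 0 < fparam x) {p : (Fin n → ℝ) → ℝ≥0∞}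
    (hp : Measurable p) :
    (correctedLaw f fparam n p).map
        (fun z => fourierMultiplier (fun x => (f x / fparam x) ^ (-(1 / 2) : ℝ)) n *ᵥ z)
      = normalizedLaw p := by
  have hunit := isUnit_correction (n := n) hf hfparam
  have hdet : 0 < (correctionMatrix (fun x => f x / fparam x) n).det := by
    rw [correctionMatrix, Matrix.det_diagonal]
    exact Finset.prod_pos fun i _ => div_pos (hf _ (fourierFreq_half_mem_Icc i))
      (hfparam _ (fourierFreq_half_mem_Icc i))
  have hcorr : correctedLaw f fparam n p = normalizedLaw fun z =>
      p (fourierMultiplier (fun x => (f x / fparam x) ^ (-(1 / 2) : ℝ)) n *ᵥ z) :=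
    normalizedLaw_const_mul (by simpa using Real.rpow_pos_of_pos hdet _) ENNReal.ofReal_ne_top
      (hp.comp (measurableEmbedding_mulVec hunit).measurable)
  rw [hcorr, map_normalizedLaw_mulVec hunit hp]

end CorrectedLaw

section Contiguity

variable {Ω Ω' : Type*} [MeasurableSpace Ω] [MeasurableSpace Ω'] {P : Measure Ω} {P' : Measure Ω'}
  {Z : ℕ → Ω → ℝ} {Y : ℕ → Ω' → ℝ} {γ₀ γparam : ℤ → ℝ}

lemma IsStationaryGaussianSeries.mutuallyContiguous_seriesLaw_whittleLaw
    (hZ : IsStationaryGaussianSeries P Z γ₀) (hγ₀ : ShortMemory γ₀) :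
    MutuallyContiguous (fun n => seriesLaw P Z n) fun n => whittleLaw (spectralDensity γ₀) n :=
  (hZ.powerDominated_seriesLaw_whittleLaw hγ₀).mutuallyContiguous
    (hZ.powerDominated_whittleLaw_seriesLaw hγ₀)

lemma IsStationaryGaussianSeries.mutuallyContiguous_whittleLaw_correctedLaw
    (hY : IsStationaryGaussianSeries P' Y γparam) (hγparam : ShortMemory γparam)
    (hγ₀ : ShortMemory γ₀) :
    MutuallyContiguous (fun n => whittleLaw (spectralDensity γ₀) n) fun n =>
      correctedLaw (spectralDensity γ₀) (spectralDensity γparam) n (seriesDensity P' Y n) := by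
  have hpos (x : ℝ) (hx : x ∈ Set.Icc 0 Real.pi) := hγ₀.spectralDensity_pos hx
  have hpos' (x : ℝ) (hx : x ∈ Set.Icc 0 Real.pi) := hγparam.spectralDensity_pos hx
  have hemb (n : ℕ) := measurableEmbedding_mulVec (isUnit_correction (n := n) hpos hpos')
  have hwhittle (n : ℕ) := map_correction_whittleLaw (n := n) hpos hpos'
    (spectralDensity_two_pi_sub hγ₀.summable_abs) (spectralDensity_two_pi_sub hγparam.summable_abs)
  have hcorrected (n : ℕ) := (map_correction_correctedLaw hpos hpos'
    (Measure.measurable_rnDeriv (seriesLaw P' Y n) volume)).trans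
    (hY.normalizedLaw_seriesDensity hγparam n)
  refine PowerDominated.mutuallyContiguous (.of_map hemb ?_) (.of_map hemb ?_)
  · simp only [hwhittle, seriesDensity, hcorrected]
    exact hY.powerDominated_whittleLaw_seriesLaw hγparam
  · simp only [hwhittle, seriesDensity, hcorrected]
    exact hY.powerDominated_seriesLaw_whittleLaw hγparam

end Contiguity

end Whittle

theorem mainTheorem2_general
    {Ω Ω' : Type*} [MeasurableSpace Ω] [MeasurableSpace Ω'] {P : Measure Ω} {P' : Measure Ω'}
    {Z : ℕ → Ω → ℝ} {γ₀ : ℤ → ℝ} {Y : ℕ → Ω' → ℝ} {γparam : ℤ → ℝ}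
    (hY : Whittle.IsStationaryGaussianSeries P' Y γparam) (hγparam : Whittle.ShortMemory γparam)
    (hZ : Whittle.IsStationaryGaussianSeries P Z γ₀) (hγ₀ : Whittle.ShortMemory γ₀) :
    Whittle.MutuallyContiguous
      (fun n => Whittle.seriesLaw P Z n)
      (fun n => Whittle.whittleLaw (Whittle.spectralDensity γ₀) n) ∧
    Whittle.MutuallyContiguous
      (fun n => Whittle.whittleLaw (Whittle.spectralDensity γ₀) n)
      (fun n => Whittle.correctedLaw (Whittle.spectralDensity γ₀)
        (Whittle.spectralDensity γparam) n (Whittle.seriesDensity P' Y n)) ∧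
    Whittle.MutuallyContiguous
      (fun n => Whittle.seriesLaw P Z n)
      (fun n => Whittle.correctedLaw (Whittle.spectralDensity γ₀)
        (Whittle.spectralDensity γparam) n (Whittle.seriesDensity P' Y n)) := by
  have hwhittle := hZ.mutuallyContiguous_seriesLaw_whittleLaw hγ₀
  have hcorrected := hY.mutuallyContiguous_whittleLaw_correctedLaw hγparam hγ₀
  exact ⟨hwhittle, hcorrected, hwhittle.trans hcorrected⟩

theorem mainTheorem2
    {Ω Ω' : Type*} [MeasurableSpace Ω] [MeasurableSpace Ω']
    (P : Measure Ω) [IsProbabilityMeasure P] (P' : Measure Ω') [IsProbabilityMeasure P']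
    (Z : ℕ → Ω → ℝ) (γ₀ : ℤ → ℝ) (Y : ℕ → Ω' → ℝ) (γparam : ℤ → ℝ)
    (hY : Whittle.IsStationaryGaussianSeries P' Y γparam)
    (hγparam : Whittle.SpectralAssumption γparam)
    (hZ : Whittle.IsStationaryGaussianSeries P Z γ₀)
    (hγ₀ : Whittle.SpectralAssumption γ₀) :
    Whittle.MutuallyContiguous
      (fun n => Whittle.seriesLaw P Z n)
      (fun n => Whittle.whittleLaw (Whittle.spectralDensity γ₀) n) ∧
    Whittle.MutuallyContiguous
      (fun n => Whittle.whittleLaw (Whittle.spectralDensity γ₀) n)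
      (fun n => Whittle.correctedLaw (Whittle.spectralDensity γ₀)
        (Whittle.spectralDensity γparam) n (Whittle.seriesDensity P' Y n)) ∧
    Whittle.MutuallyContiguous
      (fun n => Whittle.seriesLaw P Z n)
      (fun n => Whittle.correctedLaw (Whittle.spectralDensity γ₀)
        (Whittle.spectralDensity γparam) n (Whittle.seriesDensity P' Y n)) :=
  mainTheorem2_general hY hγparam.shortMemory hZ hγ₀.shortMemory
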